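/- Let $q$ be a power of a prime $p$, let $A=\mathbb F_q[t]$, let $F$ be a finite separable extension of $\mathbb F_q(t)$, and let $K/F$ be a finite abelian extension with Galois group $G$, such that $\mathbb F_q$ is algebraically closed in $K$. Let $\mathcal O_F$ and $\mathcal O_K$ be the integral closures of $A$ in $F$ and $K$. Let $\tau$ denote the $q$-power Frobenius, and let $\mathcal O_F\{\tau\}$ be the twisted polynomial ring, with $\tau x=x^q\tau$ for $x\in\mathcal O_F$. For an $\mathbb F_q$-algebra morphism $\varphi_E:\mathbb F_q[t]\to\mathcal O_F\{\tau\}$ with $\varphi_E(t)=t\tau^0+a_1\tau+\dots+a_r\tau^r$, $a_r\neq 0$, $r\ge 0$ (a Drinfeld module $E$ of rank $r$), and an $\mathcal O_F\{\tau\}[G]$-module $M$, let $E(M)$ be the $\mathbb F_q[t][G]$-module that equals $M$ as an $\mathbb F_q[G]$-module and on which $t$ acts as $\varphi_E(t)$. The Carlitz module $C$ is given by $\varphi_C(t)=t+\tau$. For an $A[G]$-module $M$ that is free of finite rank over $\mathbb F_q[G]$, let $|M|_G\in\mathbb F_q[G][t]$ be the unique monic generator of the Fitting ideal $\mathrm{Fitt}^0_{A[G]}(M)$.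 Let $v$ be a maximal ideal of $\mathcal O_F$ that is tamely ramified in $K/F$ (that is, $p$ divides no ramification index over $v$; unramified is allowed), write $\mathcal O_K/v:=\mathcal O_K/v\mathcal O_K$, put $v_0:=v\cap A$, and let $Nv\in A$ be the monic generator of $v_0^{f(v/v_0)}$, where $f(v/v_0)=[\mathcal O_F/v:A/v_0]$. Then: 1. For every Drinfeld module $E$ as above, the $\mathbb F_q[G]$-modules $\mathcal O_K/v$ and $E(\mathcal O_K/v)$ are free of rank $n_v:=[\mathcal O_F/v:\mathbb F_q]$. 2. $|\mathcal O_K/v|_G=Nv$. 3. For the Carlitz module $C$, $$|C(\mathcal O_K/v)|_G=Nv-\mathbf e_v\cdot\sigma_v,$$ where $w$ is any maximal ideal of $\mathcal O_K$ above $v$, $I_v\subseteq G$ is the inertia group of $w$, $\mathbf e_v=\frac1{|I_v|}\sum_{\sigma\in I_v}\sigma\in\mathbb F_q[G]$, and $\sigma_v\in G$ is any Frobenius element for $w$, that is, any $\sigma_v$ with $\sigma_v(x)\equiv x^{q^{n_v}}\pmod w$ for all $x\in\mathcal O_K$. -/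

import Mathlib

open Polynomial
open scoped IsMulCommutative RatFunc

noncomputable section

set_option linter.unusedSectionVars false

namespace DrinfeldEuler

/-! ### Fitting ideals and monic generators -/

/-- The zeroth Fitting ideal of a finitely generated module `M` over a commutative ring `S`: the
ideal generated by the maximal minors `det A`, where the rows of the square matrix `A` are relations
between the members of a finite generating family `x` of `M`. (By Fitting's lemma each single
generating family already yields the whole ideal.) -/
def fittingIdeal (S M : Type*) [CommRing S] [AddCommGroup M] [Module S M] : Ideal S :=
  Ideal.span {d : S | ∃ (n : ℕ) (x : Fin n → M) (A : Matrix (Fin n) (Fin n) S),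
    Submodule.span S (Set.range x) = ⊤ ∧ (∀ i, ∑ j, A i j • x j = 0) ∧ d = A.det}

/-- A monic generator of a principal ideal of `R[X]` is unique. -/
theorem monic_generator_unique {R : Type*} [CommRing R] {f g : R[X]} (hf : f.Monic) (hg : g.Monic)
    (h : Ideal.span {f} = Ideal.span {g}) : f = g := by
  nontriviality R
  have hfg : f ∣ g := Ideal.mem_span_singleton.1 (h ▸ Ideal.mem_span_singleton_self g)
  have hgf : g ∣ f := Ideal.mem_span_singleton.1 (h ▸ Ideal.mem_span_singleton_self f)
  obtain ⟨a, rfl⟩ := hfg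
  obtain ⟨b, hb⟩ := hgf
  have ha : a.Monic := hf.of_mul_monic_left hg
  have hab : a * b = 1 := by
    have : f * (a * b) = f * 1 := by rw [mul_one, ← mul_assoc, ← hb]
    exact hf.isRegular.left this
  have := ha.eq_one_of_isUnit (IsUnit.of_mul_eq_one b hab)
  rw [this, mul_one]

open Classical in
/-- The unique monic generator of the ideal `I` of `R[X]`; it is `0` if `I` has no monic
generator. -/
def monicGenerator {R : Type*} [CommRing R] (I : Ideal R[X]) : R[X] :=
  if h : ∃ f : R[X], f.Monic ∧ Ideal.span {f} = I then h.choose else 0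

theorem monicGenerator_eq {R : Type*} [CommRing R] {I : Ideal R[X]} {f : R[X]} (hf : f.Monic)
    (h : Ideal.span {f} = I) : monicGenerator I = f := by
  have hex : ∃ f : R[X], f.Monic ∧ Ideal.span {f} = I := ⟨f, hf, h⟩
  rw [monicGenerator, dif_pos hex]
  exact monic_generator_unique hex.choose_spec.1 hf (hex.choose_spec.2.trans h.symm)

/-- The `R[t]`-size `|M|` of an `R[t]`-module `M`: the monic generator of its zeroth Fitting ideal.
For `R = 𝔽_q[G]` this is the `A[G]`-size, `A = 𝔽_q[t]`. -/
def size (R M : Type*) [CommRing R] [AddCommGroup M] [Module R[X] M] : R[X] :=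
  monicGenerator (fittingIdeal R[X] M)

/-! ### Twisted polynomials and Drinfeld modules

`k` is the finite field with `q` elements. -/

section Drinfeld

variable (k : Type*) [Field k] [Fintype k] (R : Type*) [CommRing R] [Algebra k R]

/-- A copy of the `k`-algebra `R`, on which the monoid `ℕ` acts through powers of the `q`-Frobenius
`τ`, `q = #k`. -/
@[nolint unusedArguments]
def Twist (_k : Type*) (R : Type*) : Type _ := R

instance : CommRing (Twist k R) := inferInstanceAs (CommRing R)

instance : Algebra k (Twist k R) := inferInstanceAs (Algebra k R)

instance [Nontrivial R] : Nontrivial (Twist k R) := inferInstanceAs (Nontrivial R)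

/-- The identity `R → Twist k R`. -/
def toTwist : R ≃ₐ[k] Twist k R := AlgEquiv.refl

/-- `n` acts on `R` as `τ ^ n`, that is, by `x ↦ x ^ (q ^ n)`. -/
instance : MulSemiringAction (Multiplicative ℕ) (Twist k R) where
  smul n x := (FiniteField.frobeniusAlgHom k (Twist k R) ^ n.toAdd) x
  one_smul _ := rfl
  mul_smul m n x := DFunLike.congr_fun
    (pow_add (FiniteField.frobeniusAlgHom k (Twist k R)) m.toAdd n.toAdd) x
  smul_zero n := map_zero (FiniteField.frobeniusAlgHom k (Twist k R) ^ n.toAdd)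
  smul_add n := map_add (FiniteField.frobeniusAlgHom k (Twist k R) ^ n.toAdd)
  smul_one n := map_one (FiniteField.frobeniusAlgHom k (Twist k R) ^ n.toAdd)
  smul_mul n := map_mul (FiniteField.frobeniusAlgHom k (Twist k R) ^ n.toAdd)

theorem twist_smul_def (n : Multiplicative ℕ) (x : Twist k R) :
    n • x = (FiniteField.frobeniusAlgHom k (Twist k R) ^ n.toAdd) x := rfl

instance : SMulCommClass (Multiplicative ℕ) k (Twist k R) :=
  ⟨fun n c x => map_smul (FiniteField.frobeniusAlgHom k (Twist k R) ^ n.toAdd) c x⟩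

/-- The twisted polynomial ring `R{τ}`, with `τ * x = x ^ q * τ` for `x ∈ R`. -/
abbrev TwistedPoly := SkewPolynomial (Twist k R)

/-- The commutation rule of `R{τ}`. -/
theorem tau_mul (x : Twist k R) :
    (SkewPolynomial.X : TwistedPoly k R) * SkewPolynomial.C x =
      SkewPolynomial.C (x ^ Fintype.card k) * SkewPolynomial.X := by
  rw [← SkewPolynomial.monomial_one_one_eq_X, SkewPolynomial.monomial_mul_C,
    SkewPolynomial.C_mul_monomial, one_mul, mul_one]
  rfl

/-- A Drinfeld module on `k[t]` with values in `R{τ}`, for a `k[t]`-algebra `R`: a `k`-algebra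
morphism `φ : k[t] → R{τ}` such that `φ(t) = t τ^0 + a_1 τ + ... + a_r τ^r` with `a_r ≠ 0`; the
number `r ≥ 0` is the rank. -/
structure DrinfeldModule [Algebra k[X] R] where
  /-- the morphism `φ` -/
  φ : k[X] →ₐ[k] TwistedPoly k R
  /-- the rank `r` -/
  rank : ℕ
  coeff_zero : (φ X).coeff 0 = toTwist k R (algebraMap k[X] R X)
  coeff_rank : SkewPolynomial.coeff (φ X) rank ≠ 0
  coeff_of_rank_lt : ∀ i, rank < i → SkewPolynomial.coeff (φ X) i = 0

/-- The Carlitz module `φ(t) = t + τ`. -/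
def carlitz [Algebra k[X] R] [Nontrivial R] : DrinfeldModule k R where
  φ := aeval (SkewPolynomial.C (toTwist k R (algebraMap k[X] R X)) + SkewPolynomial.X)
  rank := 1
  coeff_zero := by
    rw [aeval_X, SkewPolynomial.coeff_add, SkewPolynomial.coeff_C_zero, SkewPolynomial.coeff_X_zero,
      add_zero]
  coeff_rank := by
    simp [aeval_X, SkewPolynomial.coeff_add, SkewPolynomial.coeff_X]
  coeff_of_rank_lt i hi := by
    have h0 : i ≠ 0 := by omega
    have h1 : 1 ≠ i := by omega
    simp [aeval_X, SkewPolynomial.coeff_add, SkewPolynomial.coeff_C, SkewPolynomial.coeff_X, h0, h1]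

/-- An action of the monoid `G` on the `R`-algebra `S` by `R`-algebra endomorphisms. -/
abbrev AlgAction (G R S : Type*) [Monoid G] [CommRing R] [CommRing S] [Algebra R S] : Type _ :=
  G →* (S →ₐ[R] S)

variable {k R}
variable {S : Type*} [CommRing S] [Algebra R S] [Algebra k S] [IsScalarTower k R S]
variable {G : Type*} [CommGroup G] (ρ : AlgAction G R S)

variable (k) in
/-- The `k`-linear representation underlying an action of `G` on an `R`-algebra `S` by `R`-algebra
endomorphisms. The type `(rep k ρ).asModule` is `S`, regarded as a `k[G]`-module. -/
def rep : Representation k G S where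
  toFun g := ((ρ g).restrictScalars k).toLinearMap
  map_one' := by ext; simp
  map_mul' g h := by ext; simp

/-- A `k`-linear endomorphism of `S` that commutes with `G`, as a `k[G]`-linear endomorphism. -/
def equivariantEnd (f : S →ₗ[k] S) (h : ∀ g x, f (ρ g x) = ρ g (f x)) :
    Module.End (MonoidAlgebra k G) (rep k ρ).asModule :=
  MonoidAlgebra.equivariantOfLinearOfComm
    ((rep k ρ).asModuleEquiv.symm.toLinearMap ∘ₗ f ∘ₗ (rep k ρ).asModuleEquiv.toLinearMap)
    (fun g v => by
      rw [Representation.single_smul, Representation.single_smul, one_smul, one_smul]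
      exact h g v)

theorem equivariantEnd_apply (f : S →ₗ[k] S) (h : ∀ g x, f (ρ g x) = ρ g (f x)) (x : S) :
    equivariantEnd ρ f h ((rep k ρ).asModuleEquiv.symm x) = (rep k ρ).asModuleEquiv.symm (f x) :=
  rfl

variable (k) in
/-- `R` acts on the `k[G]`-module `S` by multiplication. -/
def mulEnd : R →+* Module.End (MonoidAlgebra k G) (rep k ρ).asModule where
  toFun a := equivariantEnd ρ (Algebra.lsmul k k S a) (fun g x => by simp)
  map_one' := LinearMap.ext fun x => one_smul R ((rep k ρ).asModuleEquiv x)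
  map_mul' a b := LinearMap.ext fun x => mul_smul a b ((rep k ρ).asModuleEquiv x)
  map_zero' := LinearMap.ext fun x => zero_smul R ((rep k ρ).asModuleEquiv x)
  map_add' a b := LinearMap.ext fun x => add_smul a b ((rep k ρ).asModuleEquiv x)

theorem mulEnd_apply (a : R) (x : S) :
    mulEnd k ρ a ((rep k ρ).asModuleEquiv.symm x) = (rep k ρ).asModuleEquiv.symm (a • x) :=
  rfl

variable (k) in
/-- `τ` acts on the `k[G]`-module `S` by `x ↦ x ^ q`. -/
def frobEnd : Module.End (MonoidAlgebra k G) (rep k ρ).asModule :=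
  equivariantEnd ρ (FiniteField.frobeniusAlgHom k S).toLinearMap (fun g x => by simp)

theorem frobEnd_apply (x : S) :
    frobEnd k ρ ((rep k ρ).asModuleEquiv.symm x) =
      (rep k ρ).asModuleEquiv.symm (x ^ Fintype.card k) :=
  rfl

theorem frobEnd_pow_mulEnd (m : ℕ) (y : R) (s : (rep k ρ).asModule) :
    (frobEnd k ρ ^ m) (mulEnd k ρ y s) =
      mulEnd k ρ ((FiniteField.frobeniusAlgHom k R ^ m) y) ((frobEnd k ρ ^ m) s) := by
  induction m generalizing y s with
  | zero => rfl
  | succ m ih =>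
    have h1 : frobEnd k ρ (mulEnd k ρ y s) =
        mulEnd k ρ (FiniteField.frobeniusAlgHom k R y) (frobEnd k ρ s) :=
      smul_pow y ((rep k ρ).asModuleEquiv s) (Fintype.card k)
    rw [pow_succ, pow_succ, Module.End.mul_apply, Module.End.mul_apply, h1, ih]
    rfl

/-- The action of `R{τ}` on the `k[G]`-module `S`, which makes `S` an `R{τ}[G]`-module. -/
def twistedAction : TwistedPoly k R →+* Module.End (MonoidAlgebra k G) (rep k ρ).asModule :=
  SkewMonoidAlgebra.liftNCRingHom ((mulEnd k ρ).comp ((toTwist k R).symm : Twist k R →+* R))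
    (powersHom _ (frobEnd k ρ))
    (fun {x n} => LinearMap.ext fun s => (frobEnd_pow_mulEnd ρ n.toAdd x s).symm)

variable (k) in
/-- `S` as a `k[G][t]`-module: `k[G]` acts as on `S`, and `t` acts as multiplication by the image
of `t`. -/
abbrev tModule [Algebra k[X] R] : Type _ :=
  Module.AEval' (mulEnd k ρ (algebraMap k[X] R X))

/-- `E(S)` as a `k[G][t]`-module: `k[G]` acts as on `S`, and `t` acts as
`φ(t) = t τ^0 + a_1 τ + ... + a_r τ^r`. -/
abbrev DrinfeldModule.points [Algebra k[X] R] (E : DrinfeldModule k R) : Type _ :=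
  Module.AEval' (twistedAction ρ (E.φ X))

end Drinfeld

/-! ### Rings of integers and primes in extensions of function fields -/

section Arithmetic

variable (k : Type*) [Field k]

/-- `𝒪_L`: the integral closure of `k[t]` in `L`. -/
abbrev Integers (L : Type*) [Field L] [Algebra k[X] L] := integralClosure k[X] L

variable {F K : Type*} [Field F] [Field K] [Algebra k[X] F] [Algebra k[X] K] [Algebra F K]
  [IsScalarTower k[X] F K]

/-- The inclusion `𝒪_F → 𝒪_K`. -/
instance : Algebra (Integers k F) (Integers k K) :=
  ((IsScalarTower.toAlgHom k[X] F K).mapIntegralClosure).toRingHom.toAlgebra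

instance [Algebra k F] [Algebra k K] [IsScalarTower k k[X] F] [IsScalarTower k k[X] K] :
    IsScalarTower k (Integers k F) (Integers k K) :=
  IsScalarTower.of_algebraMap_eq fun c => Subtype.ext (by
    change algebraMap k K c = algebraMap F K (algebraMap k F c)
    rw [IsScalarTower.algebraMap_apply k k[X] K, IsScalarTower.algebraMap_apply k k[X] F,
      IsScalarTower.algebraMap_apply k[X] F K])

instance : IsScalarTower k[X] (Integers k F) (Integers k K) :=
  IsScalarTower.of_algebraMap_eq fun c => Subtype.ext (by
    change algebraMap k[X] K c = algebraMap F K (algebraMap k[X] F c)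
    rw [IsScalarTower.algebraMap_apply k[X] F K])

instance : SMulCommClass Gal(K/F) k[X] K :=
  ⟨fun g f x => by
    rw [← algebraMap_smul F f x, ← algebraMap_smul F f (g • x), smul_comm]⟩

instance : SMulCommClass Gal(K/F) (Integers k F) (Integers k K) :=
  ⟨fun g a x => Subtype.ext (by
    change g ((algebraMap F K a) * x) = algebraMap F K a * g x
    rw [map_mul, AlgEquiv.commutes])⟩

/-- `v 𝒪_K`. -/
abbrev extend (K : Type*) [Field K] [Algebra k[X] K] [Algebra F K]
    [IsScalarTower k[X] F K] (v : Ideal (Integers k F)) : Ideal (Integers k K) :=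
  v.map (algebraMap (Integers k F) (Integers k K))

variable {k}

variable (K) in
/-- The action of `Gal(K/F)` on `𝒪_K / v 𝒪_K`. -/
def galQuot (v : Ideal (Integers k F)) :
    AlgAction Gal(K/F) (Integers k F) (Integers k K ⧸ extend k K v) where
  toFun g := Ideal.quotientMapₐ _ (MulSemiringAction.toAlgHom (Integers k F) (Integers k K) g)
    (Ideal.map_le_iff_le_comap.2 fun a ha => by
      rw [Ideal.mem_comap, Ideal.mem_comap, AlgHom.commutes]
      exact Ideal.mem_map_of_mem _ ha)
  map_one' := Ideal.Quotient.algHom_ext _ (AlgHom.ext fun x =>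
    congrArg (Ideal.Quotient.mk (extend k K v)) (one_smul Gal(K/F) x))
  map_mul' g h := Ideal.Quotient.algHom_ext _ (AlgHom.ext fun x =>
    congrArg (Ideal.Quotient.mk (extend k K v)) (mul_smul g h x))

variable (K) in
/-- `v` is tamely ramified in `K/F`: no ramification index of a prime of `𝒪_K` above `v` is divisible
by the characteristic. (The residue field extensions are separable, as the residue fields are
finite.) -/
def TamelyRamified (v : Ideal (Integers k F)) : Prop :=
  ∀ w : Ideal (Integers k K), w.IsMaximal → w.LiesOver v →
    ¬ ringChar k ∣ w.ramificationIdx (Integers k F)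

/-- `Nv`: the monic generator of `v_0 ^ f(v/v_0)`, where `v_0 = v ∩ k[t]`. -/
def normPoly (v : Ideal (Integers k F)) : k[X] :=
  monicGenerator ((v.under k[X]) ^ v.inertiaDeg k[X])

open Classical in
/-- For a subgroup `I` of a finite group `G`, the element `|I|⁻¹ ∑_{σ ∈ I} σ` of `k[G]`. -/
def trivialIdempotent {G : Type*} [Group G] [Fintype G] (I : Subgroup G) : MonoidAlgebra k G :=
  (Nat.card I : k)⁻¹ • ∑ σ : I, MonoidAlgebra.of k G σ

end Arithmetic

end DrinfeldEuler

end

open DrinfeldEuler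

set_option linter.unusedSectionVars false

namespace DrinfeldEuler

/-! Write κ = 𝒪_F/v, S = 𝒪_K/v, q = #k and n = [κ : k]. Everything rests on S being free of rank one
over κ[G]. A generator identifies S with κ[G], which is free of rank n over k[G]; this settles
freeness for every action of t. Under the identification t becomes multiplication by its residue,
and τ becomes x ↦ Fr(x)·u, where Fr raises coefficients to the q-th power and u represents the q-th
power of the generator.

The Fitting ideal attached to an endomorphism of a free module is generated by its characteristic
polynomial (`fittingIdeal_aeval`). Over κ[G] the Moore matrix of a k-basis of κ conjugates t + τ
into a diagonal plus a cyclic matrix, so the polynomial is ∏(X − t^(q^j)) − ∏ Fr^j(u)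
(`charpoly_add_semilinear`). The first product is Nv; the second is the element of κ[G] taking the
generator to its q^n-th power (`pow_eq_evalNormal_prod`).

Tameness enters twice. It gives the generator (`exists_normal_basis`): κ[G] is a Frobenius algebra,
so a faithful module has an element with trivial annihilator, and dimension #G makes it a generator.
Faithfulness is tested at one prime w: the decomposition group acts on powers of a uniformizer
through the tame character, Dedekind independence separates the classes modulo inertia, and a
Vandermonde argument separates the elements of inertia.

It also makes the q^n-power map on S equal to e_v σ_v (`frobenius_sub_pow_mem`). For x₀ fixed by
inertia, σ_v x₀ − x₀^(q^n) is a fixed element of w, hence lies in w^e with e = #I_v. The rest, x −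
x₀, lies in w, so its q^n-th power lies in w^e as soon as e ≤ q^n; this holds because G is abelian
(`card_inertia_le`). -/

/-! ### Fitting ideals and characteristic polynomials -/

open Matrix in
/-- A square presentation matrix `T` divides every maximal minor of relations. -/
theorem det_dvd_det_of_relations {S M ι κ : Type*} [CommRing S] [AddCommGroup M] [Module S M]
    [Fintype ι] [DecidableEq ι] [Fintype κ] [DecidableEq κ] {e : ι → M} {T : Matrix ι ι S}
    (he : Submodule.span S (Set.range e) = ⊤)
    (hT : ∀ α : ι → S, ∑ j, α j • e j = 0 → ∃ y : ι → S, α = y ᵥ* T)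
    {x : κ → M} (hx : Submodule.span S (Set.range x) = ⊤) {A : Matrix κ κ S}
    (hA : ∀ i, ∑ j, A i j • x j = 0) : T.det ∣ A.det := by
  obtain ⟨B, hB⟩ : ∃ B : Matrix κ ι S, ∀ i, ∑ j, B i j • e j = x i := Classical.skolem.1 fun i =>
    (Submodule.mem_span_range_iff_exists_fun S).1 (he ▸ Submodule.mem_top)
  obtain ⟨C, hC⟩ : ∃ C : Matrix ι κ S, ∀ i, ∑ j, C i j • x j = e i := Classical.skolem.1 fun i =>
    (Submodule.mem_span_range_iff_exists_fun S).1 (hx ▸ Submodule.mem_top)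
  have hcomp : ∀ c : κ → S, ∑ j, (c ᵥ* B) j • e j = ∑ i, c i • x i := by
    intro c
    simp_rw [vecMul, dotProduct, Finset.sum_smul, ← hB, Finset.smul_sum, smul_smul]
    rw [Finset.sum_comm]
  obtain ⟨Y, hY⟩ : ∃ Y : Matrix κ ι S, ∀ i, A i ᵥ* B = Y i ᵥ* T := Classical.skolem.1 fun i =>
    hT _ ((hcomp (A i)).trans (hA i))
  obtain ⟨Z, hZ⟩ : ∃ Z : Matrix ι ι S, ∀ i, -(C i ᵥ* B) + Pi.single i 1 = Z i ᵥ* T := by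
    refine Classical.skolem.1 fun i => hT _ ?_
    have h5 : ∑ j, (C i ᵥ* B) j • e j = e i := (hcomp (C i)).trans (hC i)
    simp only [Pi.add_apply, Pi.neg_apply, add_smul, neg_smul, Finset.sum_add_distrib,
      Finset.sum_neg_distrib, h5, Pi.single_apply, ite_smul, one_smul, zero_smul,
      Finset.sum_ite_eq', Finset.mem_univ, if_true, neg_add_cancel]
  have hY' : A * B = Y * T := Matrix.ext fun i j => congrFun (hY i) j
  have hZ' : -(C * B) + 1 = Z * T := Matrix.ext fun i j => by
    refine Eq.trans ?_ (congrFun (hZ i) j)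
    rw [Matrix.add_apply, one_eq_pi_single]
    rfl
  -- Both factors on the left are block triangular, with determinants `A.det` and 1; the right side
  -- has the factor `T.det`.
  have key : fromBlocks A 0 (-C) 1 * fromBlocks 1 B 0 1 =
      fromBlocks A Y (-C) Z * fromBlocks 1 0 0 T := by
    simp [fromBlocks_multiply, hY', ← hZ']
  have := congrArg det key
  rw [det_mul, det_mul, det_fromBlocks_zero₁₂, det_fromBlocks_zero₂₁, det_fromBlocks_zero₂₁] at this
  simp only [det_one, mul_one, one_mul] at this
  rw [this]
  exact dvd_mul_left _ _

open Matrix in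
/-- The Fitting ideal of a module with a square presentation matrix `T` is generated by `det T`. -/
theorem fittingIdeal_eq_span_det {S M ι : Type*} [CommRing S] [AddCommGroup M] [Module S M]
    [Fintype ι] [DecidableEq ι] {e : ι → M} {T : Matrix ι ι S}
    (he : Submodule.span S (Set.range e) = ⊤) (hTe : ∀ i, ∑ j, T i j • e j = 0)
    (hT : ∀ α : ι → S, ∑ j, α j • e j = 0 → ∃ y : ι → S, α = y ᵥ* T) :
    fittingIdeal S M = Ideal.span {T.det} := by
  apply le_antisymm
  · rw [fittingIdeal, Ideal.span_le]
    rintro d ⟨n, x, A, hx, hA, rfl⟩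
    exact Ideal.mem_span_singleton.2 (det_dvd_det_of_relations he hT hx hA)
  · rw [Ideal.span_singleton_le_iff_mem]
    let σ := Fintype.equivFin ι
    refine Ideal.subset_span ⟨Fintype.card ι, e ∘ σ.symm, T.submatrix σ.symm σ.symm, ?_, ?_, ?_⟩
    · rw [Set.range_comp, σ.symm.surjective.range_eq, Set.image_univ, he]
    · intro i
      rw [← hTe (σ.symm i)]
      exact Fintype.sum_equiv σ.symm _ _ fun j => rfl
    · rw [det_submatrix_equiv_self]

-- Division with remainder by X − N, which is monic of degree one in X: modulo its rows, X times a
-- constant vector is again constant.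
open Matrix in
theorem exists_eq_vecMul_charmatrix_add {R ι : Type*} [CommRing R] [Fintype ι] [DecidableEq ι]
    (N : Matrix ι ι R) (α : ι → R[X]) :
    ∃ (y : ι → R[X]) (c : ι → R), α = y ᵥ* N.charmatrix + fun i => C (c i) := by
  have hX : ∀ c : ι → R, (fun i => C (c i)) ᵥ* N.charmatrix =
      (X : R[X]) • (fun i => C (c i)) - fun i => C ((c ᵥ* N) i) := by
    intro c
    rw [charmatrix, vecMul_sub]
    congr 1
    · ext1 i
      rw [scalar_apply, vecMul_diagonal, mul_comm]
      rfl
    · ext1 i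
      simp only [vecMul, dotProduct, map_sum, map_mul]
      rfl
  let P : Submodule R[X] (ι → R[X]) :=
    { carrier := {α | ∃ (y : ι → R[X]) (c : ι → R), α = y ᵥ* N.charmatrix + fun i => C (c i)}
      add_mem' := by
        rintro _ _ ⟨y, c, rfl⟩ ⟨y', c', rfl⟩
        refine ⟨y + y', c + c', ?_⟩
        rw [add_vecMul]
        ext1 i
        simp only [Pi.add_apply, map_add]
        ring
      zero_mem' := ⟨0, 0, by ext1; simp⟩
      smul_mem' := by
        intro p α hα
        induction p using Polynomial.induction_on' with
        | add p q hp hq =>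
          obtain ⟨y, c, h⟩ := hp
          obtain ⟨y', c', h'⟩ := hq
          refine ⟨y + y', c + c', ?_⟩
          rw [add_smul, h, h', add_vecMul]
          ext1 i
          simp only [Pi.add_apply, map_add]
          ring
        | monomial n a =>
          induction n generalizing a with
          | zero =>
            obtain ⟨y, c, h⟩ := hα
            refine ⟨C a • y, a • c, ?_⟩
            rw [h, monomial_zero_left, smul_add, smul_vecMul]
            congr 1
            ext1 i
            simp
          | succ n ih =>
            obtain ⟨y, c, h⟩ := ih a
            refine ⟨(X : R[X]) • y + (fun i => C (c i)), c ᵥ* N, ?_⟩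
            rw [← X_mul_monomial, mul_smul, h, add_vecMul, hX, smul_vecMul, smul_add]
            abel }
  suffices h : P = ⊤ from (h ▸ Submodule.mem_top : α ∈ P)
  rw [eq_top_iff, ← (Pi.basisFun R[X] ι).span_eq, Submodule.span_le]
  rintro _ ⟨i, rfl⟩
  refine ⟨0, Pi.single i 1, ?_⟩
  ext1 j
  by_cases h : j = i
  · subst h; simp
  · simp [Pi.single_apply, h]

open Matrix in
/-- The Fitting ideal of the `R[X]`-module defined by an endomorphism of a free `R`-module. -/
theorem fittingIdeal_aeval {R M ι : Type*} [CommRing R] [AddCommGroup M] [Module R M]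
    [Fintype ι] [DecidableEq ι] (b : Module.Basis ι R M) (f : Module.End R M) :
    fittingIdeal R[X] (Module.AEval' f) = Ideal.span {(LinearMap.toMatrix b b f).charpoly} := by
  -- Relations are rows of a presentation matrix, whereas `toMatrix` stores images in columns; hence
  -- the transpose.
  obtain ⟨N, rfl⟩ : ∃ N : Matrix ι ι R, f = Matrix.toLin b b Nᵀ :=
    ⟨(LinearMap.toMatrix b b f)ᵀ, by rw [transpose_transpose, toLin_toMatrix]⟩
  set f := Matrix.toLin b b Nᵀ with hf
  have hC : ∀ (a : R) (m : M), (C a : R[X]) • Module.AEval'.of f m = Module.AEval'.of f (a • m) := by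
    intro a m
    rw [map_smul, ← algebraMap_smul R[X] a (Module.AEval'.of f m)]
    rfl
  have hcomb : ∀ c : ι → R, ∑ j, C (c j) • Module.AEval'.of f (b j) =
      Module.AEval'.of f (∑ j, c j • b j) := fun c => by simp_rw [hC, map_sum]
  have hN : ∀ i, ∑ j, N i j • b j = f (b i) := by
    intro i
    rw [hf, toLin_self]
    rfl
  have hrel : ∀ i, ∑ j, N.charmatrix i j • Module.AEval'.of f (b j) = 0 := by
    intro i
    simp only [charmatrix_apply, sub_smul, Finset.sum_sub_distrib,
      diagonal_apply, ite_smul, zero_smul, Finset.sum_ite_eq, Finset.mem_univ, if_true]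
    rw [sub_eq_zero, Module.AEval'.X_smul_of, hcomb, hN]
  rw [hf, LinearMap.toMatrix_toLin, charpoly_transpose]
  apply fittingIdeal_eq_span_det (e := fun i => Module.AEval'.of f (b i)) (T := N.charmatrix)
  · rw [eq_top_iff]
    intro m _
    obtain ⟨m, rfl⟩ := (Module.AEval'.of f).surjective m
    rw [← b.sum_repr m, ← hcomb]
    exact Submodule.sum_mem _ fun j _ =>
      Submodule.smul_mem _ _ (Submodule.subset_span ⟨j, rfl⟩)
  · exact hrel
  · intro α hα
    -- The constant remainder `c` is a relation over `R` between basis vectors, so it vanishes.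
    obtain ⟨y, c, rfl⟩ := exists_eq_vecMul_charmatrix_add N α
    refine ⟨y, ?_⟩
    have h0 : ∑ j, (y ᵥ* N.charmatrix) j • Module.AEval'.of f (b j) = 0 := by
      simp_rw [vecMul, dotProduct, Finset.sum_smul]
      rw [Finset.sum_comm]
      refine Finset.sum_eq_zero fun i _ => ?_
      simp_rw [mul_smul, ← Finset.smul_sum, hrel i, smul_zero]
    simp only [Pi.add_apply, add_smul, Finset.sum_add_distrib, h0, zero_add] at hα
    rw [hcomb, map_eq_zero_iff _ (Module.AEval'.of f).injective] at hα
    have hc := Fintype.linearIndependent_iff.1 b.linearIndependent c hα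
    ext1 i
    simp [hc i]

theorem size_aeval {R M ι : Type*} [CommRing R] [AddCommGroup M] [Module R M]
    [Fintype ι] [DecidableEq ι] (b : Module.Basis ι R M) (f : Module.End R M) :
    size R (Module.AEval' f) = (LinearMap.toMatrix b b f).charpoly :=
  monicGenerator_eq (Matrix.charpoly_monic _) (fittingIdeal_aeval b f).symm


/-! ### Characteristic polynomials of Frobenius-semilinear maps -/

open Matrix Equiv Fin.CommRing in
/-- The determinant of a matrix with entries on the diagonal and on a cyclic off-diagonal. -/
theorem det_diagonal_sub_cyclic {R : Type*} [CommRing R] {n : ℕ} [NeZero n] (a u : Fin n → R) :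
    (of fun i j => (if i = j then a j else 0) - if i = j + 1 then u j else 0 :
      Matrix (Fin n) (Fin n) R).det = ∏ j, a j - ∏ j, u j := by
  obtain ⟨m, rfl⟩ : ∃ m, n = m + 1 := Nat.exists_eq_succ_of_ne_zero (NeZero.ne n)
  rcases m with _ | m
  · simp
  have hne : ∀ j : Fin (m + 2), j ≠ j + 1 := fun j h => by
    have : (1 : Fin (m + 2)) = 0 := by
      have := congrArg (fun x => x - j) h
      simpa using this.symm
    simp at this
  rw [det_apply, Finset.sum_eq_add (1 : Perm (Fin (m + 2))) (finRotate (m + 2))]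
  -- The cycle of length m + 2 has sign (−1)^(m+1) and each of its m + 2 entries carries −1, so the
  -- net sign is −1.
  · simp only [Perm.sign_one, one_smul, Perm.one_apply, of_apply, if_true, sign_finRotate,
      finRotate_apply, if_neg (hne _), sub_zero, if_neg (hne _).symm, zero_sub,
      Finset.prod_neg, Finset.card_univ, Fintype.card_fin, Units.smul_def]
    rw [sub_eq_add_neg]
    congr 1
    push_cast
    rw [zsmul_eq_mul]
    push_cast
    rw [← mul_assoc, ← pow_add, Odd.neg_one_pow ⟨m + 1, by omega⟩, neg_one_mul]
  · intro h
    have := congrArg (fun σ : Perm (Fin (m + 2)) => σ 0) h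
    simp only [Perm.one_apply, finRotate_apply] at this
    exact hne 0 this
  · rintro σ - ⟨h1, h2⟩
    suffices h : ∃ j, σ j ≠ j ∧ σ j ≠ j + 1 by
      obtain ⟨j, hj, hj'⟩ := h
      rw [Finset.prod_eq_zero (Finset.mem_univ j) (by simp [hj, hj']), smul_zero]
    by_contra! hσ
    obtain ⟨i, hi⟩ : ∃ i, σ i ≠ i := by
      by_contra! h
      exact h1 (Perm.ext h)
    -- If `j` moves, its image `j + 1` is already taken, so `j + 1` moves too. One moved point
    -- therefore forces the full cycle.
    have hstep : ∀ j, σ j ≠ j → σ (j + 1) ≠ j + 1 := fun j hj h => by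
      have h3 := hσ j hj
      exact hne j (σ.injective (h3.trans h.symm))
    have hall : ∀ k : ℕ, σ (i + (k : Fin (m + 2))) ≠ i + (k : Fin (m + 2)) := by
      intro k
      induction k with
      | zero => simpa using hi
      | succ k ih =>
        have := hstep _ ih
        rwa [add_assoc, ← Nat.cast_succ] at this
    apply h2
    ext1 j
    rw [finRotate_apply]
    apply hσ
    have := hall ((j - i : Fin (m + 2)) : ℕ)
    rwa [Fin.cast_val_eq_self, add_sub_cancel] at this
  · simp
  · simp

open Matrix in
/-- The characteristic polynomial of the semilinear map `x ↦ t x + φ x · u`, where `φ` is an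
automorphism of order dividing `n` such that the matrix `φ^j (β_i)` is invertible. -/
theorem charpoly_add_semilinear {R A : Type*} [CommRing R] [CommRing A] [Algebra R A] {n : ℕ}
    [NeZero n] (β : Module.Basis (Fin n) R A) (φ : A →ₐ[R] A) (hφ : φ ^ n = 1)
    (hdet : IsUnit (of fun i j : Fin n => (φ ^ (j : ℕ)) (β i)).det)
    (t u : A) (f : A →ₗ[R] A) (hf : ∀ x, f x = t * x + φ x * u) :
    (LinearMap.toMatrix β β f).charpoly.map (algebraMap R A) =
      ∏ j : Fin n, (X - C ((φ ^ (j : ℕ)) t)) - C (∏ j : Fin n, (φ ^ (j : ℕ)) u) := by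
  set V : Matrix (Fin n) (Fin n) A := of fun i j : Fin n => (φ ^ (j : ℕ)) (β i) with hV
  let N : Matrix (Fin n) (Fin n) A := of fun i j =>
    (if i = j then (φ ^ (j : ℕ)) t else 0) + if i = j + 1 then (φ ^ (j : ℕ)) u else 0
  have hsucc : ∀ j : Fin n, φ ^ ((j + 1 : Fin n) : ℕ) = φ ^ ((j : ℕ) + 1) := by
    intro j
    rw [Fin.val_add, Fin.val_one', Nat.add_mod_mod, ← pow_eq_pow_mod _ hφ]
  -- Applying φ^j to f(β_i) = t β_i + φ(β_i) u expresses it through columns j and j + 1 of `V`; the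
  -- last column wraps around because φ^n = 1.
  have key : ((LinearMap.toMatrix β β f).map (algebraMap R A))ᵀ * V = V * N := by
    ext i j
    rw [mul_apply, mul_apply]
    simp only [N, hV, of_apply, mul_add, Finset.sum_add_distrib, mul_ite, mul_zero,
      Finset.sum_ite_eq', Finset.mem_univ, if_true, hsucc, transpose_apply, map_apply]
    have h1 := congrArg (φ ^ (j : ℕ)) (hf (β i))
    rw [← β.sum_repr (f (β i)), map_sum, map_add, map_mul, map_mul, ← AlgHom.mul_apply,
      ← pow_succ] at h1
    rw [mul_comm ((φ ^ (j : ℕ)) (β i)), ← h1]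
    refine Finset.sum_congr rfl fun l _ => ?_
    rw [map_smul, Algebra.smul_def, LinearMap.toMatrix_apply]
  obtain ⟨W, hW⟩ := (isUnit_iff_isUnit_det V).2 hdet
  have h2 : ((LinearMap.toMatrix β β f).map (algebraMap R A))ᵀ = W.val * N * W⁻¹.val := by
    rw [hW, ← key, ← hW, mul_assoc, ← Units.val_mul, mul_inv_cancel, Units.val_one, mul_one]
  rw [← charpoly_map, ← charpoly_transpose, ← RingHom.mapMatrix_apply, RingHom.mapMatrix_apply, h2,
    coe_units_inv, charpoly_units_conj, map_prod, ← det_diagonal_sub_cyclic, charpoly]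
  congr 1
  ext1 i j
  rw [charmatrix_apply, of_apply, diagonal_apply, show N i j = (if i = j then (φ ^ (j : ℕ)) t else 0)
    + if i = j + 1 then (φ ^ (j : ℕ)) u else 0 from rfl, map_add, apply_ite C, apply_ite C, map_zero,
    sub_add_eq_sub_sub]
  congr 1
  split_ifs <;> simp


/-! ### Frobenius algebras and normal basis generators -/

section Frobenius

variable {κ R : Type*} [Field κ] [CommRing R] [Algebra κ R] [FiniteDimensional κ R]
  {l : R →ₗ[κ] κ}

/-- In a Frobenius algebra, nonzero elements killed by the same maximal ideal generate the same
minimal ideal. -/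
theorem mem_span_of_annihilated (hl : ∀ a, (∀ b, l (a * b) = 0) → a = 0) {m : Ideal R}
    [m.IsMaximal] {z z' : R} (hz : ∀ r ∈ m, r * z = 0) (hz' : ∀ r ∈ m, r * z' = 0) (hne : z' ≠ 0) :
    z ∈ Ideal.span {z'} := by
  by_contra hmem
  obtain ⟨f, hf, hf'⟩ := Submodule.exists_le_ker_of_notMem
    (p := (Ideal.span {z'}).restrictScalars κ) (v := z) hmem
  let B : R →ₗ[κ] Module.Dual κ R := (LinearMap.mul κ R).compr₂ l
  have hB : Function.Injective B := (injective_iff_map_eq_zero B).2 fun a ha =>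
    hl a fun b => DFunLike.congr_fun ha b
  have hBs : Function.Surjective B :=
    (LinearMap.injective_iff_surjective_of_finrank_eq_finrank
      (Subspace.dual_finrank_eq (K := κ) (V := R)).symm).1 hB
  -- By nondegeneracy the functional killing `z'` but not `z` has the form l(c ·). Then c z' = 0,
  -- which puts `c` in `m`, so `c` kills `z` as well.
  obtain ⟨c, rfl⟩ := hBs f
  have hcz' : c * z' = 0 := hl _ fun b => by
    rw [mul_assoc]
    exact hf' (Ideal.mul_mem_right b _ (Ideal.mem_span_singleton_self z'))
  have hc : c ∈ m := by
    by_contra hcm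
    obtain ⟨r, s, hs, h1⟩ := Ideal.IsMaximal.exists_inv ‹_› hcm
    apply hne
    rw [← one_mul z', ← h1, add_mul, mul_assoc, hcz', mul_zero, zero_add, hz' s hs]
  apply hf
  change l (c * z) = 0
  rw [hz c hc, map_zero]

/-- A faithful module over a commutative Frobenius algebra has an element with trivial
annihilator. -/
theorem exists_annihilator_trivial (hl : ∀ a, (∀ b, l (a * b) = 0) → a = 0)
    {M : Type*} [AddCommGroup M] [Module R M] [FaithfulSMul R M] :
    ∃ b : M, ∀ r : R, r • b = 0 → r = 0 := by
  classical
  have : IsArtinianRing R := IsArtinianRing.of_finite κ R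
  -- For each such m choose a socle element `z` and, by faithfulness, a vector it does not kill; the
  -- Chinese remainder theorem glues these vectors.
  let ι := {m : MaximalSpectrum R // ∃ z : R, z ≠ 0 ∧ ∀ r ∈ m.asIdeal, r * z = 0}
  have : Fintype ι := Fintype.ofFinite ι
  choose z hz hzm using fun i : ι => i.2
  have hz' : ∀ i, ∃ a : M, z i • a ≠ 0 := by
    intro i
    by_contra! h
    exact hz i (FaithfulSMul.eq_of_smul_eq_smul (α := M) fun a => by rw [h, zero_smul])
  choose a ha using hz'
  have hcop : Pairwise (Function.onFun IsCoprime fun i : ι => i.1.asIdeal) := by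
    intro i j hij
    rw [Function.onFun, Ideal.isCoprime_iff_sup_eq]
    exact i.1.isMaximal.coprime_of_ne j.1.isMaximal fun h =>
      hij (Subtype.ext (MaximalSpectrum.ext h))
  have hε : ∀ i : ι, ∃ ε : R, ∀ j : ι, ε - (Pi.single i 1 : ι → R) j ∈ j.1.asIdeal := fun i =>
    Ideal.exists_forall_sub_mem_ideal hcop (Pi.single i 1 : ι → R)
  choose ε hε using hε
  have hzε : ∀ i j, z i * ε j = if i = j then z i else 0 := by
    intro i j
    have := hzm i _ (hε j i)
    rw [sub_mul, sub_eq_zero, mul_comm] at this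
    rw [this, Pi.single_apply]
    split_ifs <;> simp
  refine ⟨∑ j, ε j • a j, fun r hr => ?_⟩
  by_contra hr0
  have : Nontrivial (Ideal.span {r}) := Submodule.nontrivial_iff_ne_bot.2 (by simpa using hr0)
  -- A nonzero ideal (r) contains an element whose annihilator is maximal, hence contains a chosen
  -- socle element `z i`; that element would then kill the glued vector.
  obtain ⟨P, hP⟩ := associatedPrimes.nonempty R (Ideal.span {r})
  obtain ⟨hPp, ⟨x, hxr⟩, hPx⟩ := isAssociatedPrime_iff.1 hP
  have hx : ∀ s, s ∈ P ↔ s * x = 0 := fun s => by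
    rw [hPx, Submodule.mem_colon_singleton, Submodule.mem_bot, Subtype.ext_iff]
    rfl
  have hx0 : x ≠ 0 := fun h => hPp.ne_top ((Ideal.eq_top_iff_one P).2 ((hx 1).2 (by rw [h, mul_zero])))
  have hPm : P.IsMaximal := inferInstance
  let i : ι := ⟨⟨P, hPm⟩, x, hx0, fun s hs => (hx s).1 hs⟩
  have h1 : z i ∈ Ideal.span {x} :=
    mem_span_of_annihilated hl (m := P) (hzm i) (fun s hs => (hx s).1 hs) hx0
  obtain ⟨c, hc⟩ := Ideal.mem_span_singleton'.1 h1
  obtain ⟨d, hd⟩ := Ideal.mem_span_singleton'.1 hxr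
  apply ha i
  have h2 : z i • ∑ j, ε j • a j = z i • a i := by
    rw [Finset.smul_sum, Finset.sum_eq_single i]
    · rw [smul_smul, hzε, if_pos rfl]
    · intro j _ hj
      rw [smul_smul, hzε, if_neg hj.symm, zero_smul]
    · simp
  rw [← h2, ← hc, ← hd, mul_smul, mul_smul, hr, smul_zero, smul_zero]

end Frobenius

/-- If the operators of a finite abelian group are linearly independent, then some vector has
linearly independent translates. -/
theorem exists_linearIndependent_translates {κ G V : Type*} [Field κ] [CommGroup G] [Finite G]
    [AddCommGroup V] [Module κ V] (ρ : Representation κ G V)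
    (h : LinearIndependent κ fun g => (ρ g : V →ₗ[κ] V)) :
    ∃ b : V, LinearIndependent κ fun g => ρ g b := by
  have := Fintype.ofFinite G
  have hsum : ∀ r : MonoidAlgebra κ G, ρ.asAlgebraHom r = ∑ g, r.coeff g • ρ g := by
    intro r
    rw [Representation.asAlgebraHom_def, MonoidAlgebra.lift_apply, Finsupp.sum_fintype]
    simp
  have : FiniteDimensional κ (MonoidAlgebra κ G) := (MonoidAlgebra.basis G κ).finiteDimensional_of_finite
  have : FaithfulSMul (MonoidAlgebra κ G) ρ.asModule := by
    refine ⟨fun {r s} hrs => ?_⟩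
    have h0 : ρ.asAlgebraHom (r - s) = 0 := by
      rw [map_sub, sub_eq_zero]
      exact LinearMap.ext fun x => hrs (ρ.asModuleEquiv.symm x)
    rw [hsum] at h0
    have := Fintype.linearIndependent_iff.1 h _ h0
    rw [← sub_eq_zero]
    ext g
    exact this g
  -- The Frobenius form is the coefficient at 1; multiplying by g⁻¹ first makes it read off the
  -- coefficient at g.
  obtain ⟨b, hb⟩ := exists_annihilator_trivial (κ := κ) (R := MonoidAlgebra κ G)
    (l := Finsupp.lapply 1 ∘ₗ (MonoidAlgebra.coeffLinearEquiv κ).toLinearMap) (M := ρ.asModule) (by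
      intro a ha
      ext g
      have := ha (MonoidAlgebra.single g⁻¹ 1)
      simpa [MonoidAlgebra.coeff_mul_single_apply] using this)
  refine ⟨ρ.asModuleEquiv b, Fintype.linearIndependent_iff.2 fun c hc g => ?_⟩
  have h0 := hb (.ofCoeff (Finsupp.equivFunOnFinite.symm c)) (by
    apply ρ.asModuleEquiv.injective
    rw [Representation.asModuleEquiv_map_smul, hsum, LinearMap.sum_apply, map_zero, ← hc]
    rfl)
  exact DFunLike.congr_fun (congrArg MonoidAlgebra.coeff h0) g


/-! ### Rings of invariants of Dedekind domains -/

section FixedRing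

variable (A : Type*) {B H : Type*} [CommRing A] [CommRing B] [Algebra A B] [Group H]
  [MulSemiringAction H B] [SMulCommClass H A B]

-- A fraction of invariants that is integral over the invariants lies in `B` by normality; it is
-- fixed because its numerator and denominator are.
variable (H) in
theorem isIntegrallyClosed_fixedPoints [IsDomain B] [IsIntegrallyClosed B] :
    IsIntegrallyClosed (FixedPoints.subalgebra A B H) := by
  set C := FixedPoints.subalgebra A B H
  let f : FractionRing C →+* FractionRing B :=
    IsFractionRing.map (A := C) (B := B) (j := algebraMap C B) Subtype.val_injective
  have hf : ∀ c : C, f (algebraMap C _ c) = algebraMap B _ (c : B) := fun c =>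
    IsLocalization.map_eq _ c
  rw [isIntegrallyClosed_iff (FractionRing C)]
  intro x hx
  obtain ⟨a, b, hb, rfl⟩ := IsFractionRing.div_surjective (A := C) x
  have hb0 : (b : B) ≠ 0 := fun h => nonZeroDivisors.ne_zero hb (Subtype.ext h)
  have h1 : IsIntegral B (f (algebraMap C _ a / algebraMap C _ b)) := by
    obtain ⟨p, hp, hpx⟩ := hx
    refine ⟨p.map (algebraMap C B), hp.map _, ?_⟩
    have h2 := congrArg f hpx
    rw [hom_eval₂, map_zero] at h2
    rw [eval₂_map, ← h2]
    congr 1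
    exact RingHom.ext fun c => (hf c).symm
  obtain ⟨y, hy⟩ := IsIntegrallyClosed.isIntegral_iff.1 h1
  rw [map_div₀, hf, hf, eq_div_iff (by simpa using hb0), ← map_mul] at hy
  have hy' := IsFractionRing.injective B (FractionRing B) hy
  have hyC : y ∈ C := by
    intro h
    apply mul_right_cancel₀ hb0
    rw [hy']
    have := congrArg (fun z => h • z) hy'
    simp only [smul_mul'] at this
    rwa [b.2 h, a.2 h] at this
  refine ⟨⟨y, hyC⟩, ?_⟩
  have hbC : algebraMap C (FractionRing C) b ≠ 0 := by simpa using nonZeroDivisors.ne_zero hb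
  rw [eq_div_iff hbC, ← map_mul]
  congr 1
  exact Subtype.ext hy'

variable (H) in
theorem isDedekindDomain_fixedPoints [IsDedekindDomain A] [IsDedekindDomain B]
    [Module.Finite A B] : IsDedekindDomain (FixedPoints.subalgebra A B H) := by
  have : IsNoetherian A B := isNoetherian_of_isNoetherianRing_of_finite A B
  have : IsNoetherian A (FixedPoints.subalgebra A B H) :=
    inferInstanceAs (IsNoetherian A (FixedPoints.subalgebra A B H).toSubmodule)
  have : IsNoetherianRing (FixedPoints.subalgebra A B H) := isNoetherian_of_tower A this
  have : Algebra.IsIntegral A (FixedPoints.subalgebra A B H) := inferInstance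
  have : IsIntegrallyClosed (FixedPoints.subalgebra A B H) := isIntegrallyClosed_fixedPoints A H
  have : Ring.DimensionLEOne (FixedPoints.subalgebra A B H) := by
    refine ⟨fun {P} hP hPp => ?_⟩
    have : (P.under A).IsMaximal := Ideal.IsPrime.isMaximal inferInstance (Ideal.under_ne_bot A hP)
    exact Ideal.isMaximal_of_isIntegral_of_isMaximal_comap P this
  have : IsDedekindRing (FixedPoints.subalgebra A B H) := { }
  infer_instance

end FixedRing

/-! ### Inertia and the tame character -/

section Inertia

/-- Elements of a prime `w` fixed by a group `J` of inertia lie in `w ^ #J`. -/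
theorem mem_pow_card_of_fixed (A : Type*) {B G : Type*} [CommRing A] [CommRing B]
    [IsDedekindDomain A] [IsDedekindDomain B] [Algebra A B] [Module.Finite A B] [Group G]
    [Finite G] [MulSemiringAction G B] [IsGaloisGroup G A B]
    {w : Ideal B} [w.IsMaximal] [Finite (B ⧸ w)] (hw : w ≠ ⊥)
    {J : Subgroup G} (hJ : J ≤ w.inertia G) {y : B} (hy : y ∈ w) (hfix : ∀ g ∈ J, g • y = y) :
    y ∈ w ^ Nat.card J := by
  have : FaithfulSMul G B := IsGaloisGroup.faithful A
  have : FaithfulSMul J B := inferInstance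
  have : SMulCommClass J A B := inferInstance
  set C := FixedPoints.subalgebra A B J
  have : IsDedekindDomain C := isDedekindDomain_fixedPoints A J
  have : Module.Finite C B := Module.Finite.right A C B
  set u := w.under C
  have : Finite (C ⧸ u) := Finite.of_injective _ Ideal.algebraMap_quotient_injective
  have hu : u.IsMaximal := inferInstance
  have h1 := Ideal.card_inertia_eq_ramificationIdxIn (G := J) u w
  -- All of `J` is inertia over its fixed ring, so the ramification index there is #J, and `y` lies
  -- in the prime below.
  rw [Ideal.ramificationIdxIn_eq_ramificationIdx u w J,
    ← Ideal.ramificationIdx'_eq_ramificationIdx u w (Ideal.under_ne_bot C hw),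
    show w.inertia J = ⊤ from eq_top_iff.2 fun g _ => hJ g.2, Subgroup.card_top] at h1
  rw [h1]
  have hy' : (⟨y, fun g => hfix g.1 g.2⟩ : C) ∈ u := hy
  exact Ideal.le_pow_ramificationIdx' (Ideal.mem_map_of_mem (algebraMap C B) hy')

section Pointwise

open scoped Pointwise

variable {B G : Type*} [CommRing B] [Group G] [MulSemiringAction G B]

theorem smul_mem_of_mem_stabilizer {w : Ideal B} {g : G} (hg : g ∈ MulAction.stabilizer G w)
    {x : B} (hx : x ∈ w) : g • x ∈ w := by
  rw [← MulAction.mem_stabilizer_iff.1 hg]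
  exact Ideal.smul_mem_pointwise_smul g x w hx

theorem smul_mem_pow {w w' : Ideal B} {g : G} (h : ∀ x ∈ w, g • x ∈ w') {n : ℕ} {x : B}
    (hx : x ∈ w ^ n) : g • x ∈ w' ^ n := by
  have h1 : (w ^ n).map (MulSemiringAction.toRingHom G B g) ≤ w' ^ n := by
    rw [Ideal.map_pow]
    exact Ideal.pow_right_mono (Ideal.map_le_iff_le_comap.2 h) n
  exact h1 (Ideal.mem_map_of_mem _ hx)

theorem smul_mem_pow_of_mem_stabilizer {w : Ideal B} {g : G} (hg : g ∈ MulAction.stabilizer G w)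
    {n : ℕ} {x : B} (hx : x ∈ w ^ n) : g • x ∈ w ^ n :=
  smul_mem_pow (fun _ h => smul_mem_of_mem_stabilizer hg h) hx

/-- The elements of the inertia group of `w` that act trivially on `w / w ^ 2`. -/
def cotangentInertia (G : Type*) [Group G] [MulSemiringAction G B] (w : Ideal B) : Subgroup G where
  carrier := {g | g ∈ w.inertia G ∧ ∀ x ∈ w, g • x - x ∈ w ^ 2}
  mul_mem' {g h} hg hh := ⟨mul_mem hg.1 hh.1, fun x hx => by
    have h1 := smul_mem_pow_of_mem_stabilizer (Ideal.inertia_le_stabilizer w hg.1) (hh.2 x hx)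
    rw [smul_sub] at h1
    have := add_mem h1 (hg.2 x hx)
    rwa [sub_add_sub_cancel, ← mul_smul] at this⟩
  one_mem' := ⟨one_mem _, fun x _ => by simp⟩
  inv_mem' {g} hg := ⟨inv_mem hg.1, fun x hx => by
    have h1 := smul_mem_pow_of_mem_stabilizer
      (Ideal.inertia_le_stabilizer w (inv_mem hg.1)) (hg.2 x hx)
    rwa [smul_sub, inv_smul_smul, ← neg_mem_iff, neg_sub] at h1⟩

theorem cotangentInertia_le (w : Ideal B) : cotangentInertia G w ≤ w.inertia G := fun _ h => h.1

end Pointwise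

section Tame

open scoped Pointwise

variable {A B G : Type*} [CommRing A] [CommRing B] [IsDedekindDomain A] [IsDedekindDomain B]
  [Algebra A B] [Module.Finite A B] [Group G] [Finite G] [MulSemiringAction G B]

/-- In the tame case, the inertia group acts faithfully on `w / w ^ 2`. -/
theorem cotangentInertia_eq_bot (A : Type*) [CommRing A] [IsDedekindDomain A] [Algebra A B]
    [Module.Finite A B] [IsGaloisGroup G A B] {w : Ideal B} [w.IsMaximal] [Finite (B ⧸ w)]
    (hw : w ≠ ⊥) (hI : (Nat.card (w.inertia G) : B) ∉ w) : cotangentInertia G w = ⊥ := by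
  have := Fintype.ofFinite (cotangentInertia G w)
  set J := cotangentInertia G w
  rw [← Subgroup.card_eq_one]
  by_contra hJ1
  have hJ2 : 2 ≤ Nat.card J := by
    have := Nat.card_pos (α := J)
    omega
  obtain ⟨a, ha, ha2⟩ := Ideal.exists_mem_pow_notMem_pow_succ w hw (Ideal.IsMaximal.ne_top ‹_›) 1
  rw [pow_one] at ha
  -- The trace of a uniformizer is fixed by `J`, hence lies in w^#J ⊆ w². It is also congruent to #J
  -- · a modulo w², which would put #J in `w`, against tameness.
  set b := ∑ g : J, g • a with hb
  have hbw : b ∈ w := Submodule.sum_mem _ fun g _ =>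
    smul_mem_of_mem_stabilizer (Ideal.inertia_le_stabilizer w (cotangentInertia_le w g.2)) ha
  have hb2 : b ∈ w ^ 2 := by
    refine Ideal.pow_le_pow_right hJ2
      (mem_pow_card_of_fixed A hw (cotangentInertia_le w) hbw fun g hg => ?_)
    rw [hb, Finset.smul_sum]
    exact Fintype.sum_equiv (Equiv.mulLeft (⟨g, hg⟩ : J)) _ _ fun h => (mul_smul g h.1 a).symm
  have hsub : b - Nat.card J * a ∈ w ^ 2 := by
    have : b - Nat.card J * a = ∑ g : J, (g • a - a) := by
      rw [Finset.sum_sub_distrib, Finset.sum_const, Finset.card_univ, Nat.card_eq_fintype_card,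
        nsmul_eq_mul]
    rw [this]
    exact Submodule.sum_mem _ fun g _ => g.2.2 a ha
  have h1 : a * Nat.card J ∈ w ^ (1 + 1) := by
    have := sub_mem hb2 hsub
    rwa [sub_sub_cancel, mul_comm] at this
  have h2 : (Nat.card J : B) ∈ w := Ideal.mem_prime_of_mul_mem_pow hw ha2 h1
  obtain ⟨m, hm⟩ := Subgroup.card_dvd_of_le (cotangentInertia_le (G := G) w)
  apply hI
  rw [hm, Nat.cast_mul]
  exact Ideal.mul_mem_right _ _ h2

/-- The tame character, given by the action on a uniformizer. -/
theorem exists_tame_character (A : Type*) [CommRing A] [IsDedekindDomain A] [Algebra A B]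
    [Module.Finite A B] [IsGaloisGroup G A B] {w : Ideal B} [w.IsMaximal] [Finite (B ⧸ w)]
    (hw : w ≠ ⊥) (hI : (Nat.card (w.inertia G) : B) ∉ w) :
    ∃ a ∈ w, a ∉ w ^ 2 ∧ ∃ χ : G → B,
      (∀ g ∈ MulAction.stabilizer G w, g • a - χ g * a ∈ w ^ 2) ∧
      (∀ g ∈ MulAction.stabilizer G w, ∀ h ∈ MulAction.stabilizer G w,
        g • χ h * χ g - χ (g * h) ∈ w) ∧
      (∀ g ∈ MulAction.stabilizer G w, χ g ∉ w) ∧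
      ∀ g ∈ w.inertia G, χ g - 1 ∈ w → g = 1 := by
  classical
  obtain ⟨a, ha, ha2⟩ := Ideal.exists_mem_pow_notMem_pow_succ w hw (Ideal.IsMaximal.ne_top ‹_›) 1
  have hex : ∀ g : G, ∃ c, g ∈ MulAction.stabilizer G w → g • a - c * a ∈ w ^ 2 := by
    intro g
    by_cases hg : g ∈ MulAction.stabilizer G w
    · obtain ⟨d, e, he, h⟩ := Ideal.exists_mul_add_mem_pow_succ hw _ _ ha ha2
        (smul_mem_pow_of_mem_stabilizer hg ha)
      exact ⟨d, fun _ => by rw [← h, mul_comm d, add_sub_cancel_left]; exact he⟩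
    · exact ⟨0, fun h => absurd h hg⟩
  choose χ hχ using hex
  have hcancel : ∀ c : B, c * a ∈ w ^ 2 → c ∈ w := fun c hc =>
    Ideal.mem_prime_of_mul_mem_pow hw ha2 (by rwa [mul_comm])
  rw [pow_one] at ha
  refine ⟨a, ha, ha2, χ, hχ, fun g hg h hh => ?_, fun g hg hgw => ?_, fun g hg hgw => ?_⟩
  · apply hcancel
    have h1 := smul_mem_pow_of_mem_stabilizer hg (hχ h hh)
    rw [smul_sub, smul_mul', ← mul_smul] at h1
    have h2 := Ideal.mul_mem_left _ (g • χ h) (hχ g hg)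
    have h3 := hχ (g * h) (mul_mem hg hh)
    have := sub_mem (sub_mem h3 h1) h2
    convert! this using 1
    ring
  · have h1 : χ g * a ∈ w ^ 2 := by
      rw [pow_two]
      exact Ideal.mul_mem_mul hgw ha
    have h2 := add_mem (hχ g hg) h1
    rw [sub_add_cancel] at h2
    apply ha2
    have := smul_mem_pow_of_mem_stabilizer (inv_mem hg) h2
    rwa [inv_smul_smul] at this
  · have hmem : g ∈ cotangentInertia G w := by
      refine ⟨hg, fun x hx => ?_⟩
      have hgD := Ideal.inertia_le_stabilizer w hg
      have h0 : g • a - a ∈ w ^ 2 := by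
        have h1 : (χ g - 1) * a ∈ w ^ 2 := by
          rw [pow_two]
          exact Ideal.mul_mem_mul hgw ha
        have := add_mem (hχ g hgD) h1
        convert! this using 1
        ring
      obtain ⟨d, e, he, rfl⟩ := Ideal.exists_mul_add_mem_pow_succ hw _ _ (i := 1) (by rwa [pow_one])
        ha2 (show x ∈ w ^ 1 by rwa [pow_one])
      have h1 : (g • a) * (g • d - d) ∈ w ^ 2 := by
        rw [pow_two]
        exact Ideal.mul_mem_mul (smul_mem_of_mem_stabilizer hgD ha) (hg d)
      have h2 := Ideal.mul_mem_right d _ h0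
      have h3 := sub_mem (smul_mem_pow_of_mem_stabilizer hgD he) he
      have := add_mem (add_mem h1 h2) h3
      convert! this using 1
      rw [smul_add, smul_mul']
      ring
    rwa [cotangentInertia_eq_bot A hw hI, Subgroup.mem_bot] at hmem

end Tame

end Inertia


/-! ### Independence of the Galois group and Frobenius at one prime -/

/-- Dedekind independence of characters, for a family that may have repetitions. -/
theorem sum_fiber_eq_zero_of_monoidHom {M L ι : Type*} [Monoid M] [CommRing L] [IsDomain L]
    [Fintype ι] (ψ : ι → M →* L) (d : ι → L) (h : ∀ x, ∑ i, d i * ψ i x = 0) (f : M →* L)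
    [DecidablePred fun i => ψ i = f] : ∑ i with ψ i = f, d i = 0 := by
  classical
  have hli := linearIndependent_iff'.1 (linearIndependent_monoidHom M L) (Finset.univ.image ψ)
    (fun f => ∑ i with ψ i = f, d i) (by
      ext x
      rw [Finset.sum_apply, Pi.zero_apply, ← h x,
        ← Finset.sum_fiberwise_of_maps_to (t := Finset.univ.image ψ) (g := ψ) (by simp)]
      refine Finset.sum_congr rfl fun f _ => ?_
      rw [Pi.smul_apply, smul_eq_mul, Finset.sum_mul]
      refine Finset.sum_congr rfl fun i hi => ?_
      rw [(Finset.mem_filter.1 hi).2])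
  by_cases hf : f ∈ Finset.univ.image ψ
  · convert! hli f hf
  · refine Finset.sum_eq_zero fun i hi => absurd ?_ hf
    rw [← (Finset.mem_filter.1 hi).2]
    exact Finset.mem_image_of_mem _ (Finset.mem_univ _)

theorem eq_zero_of_forall_sum_mul_pow_eq_zero {L ι : Type*} [CommRing L] [IsDomain L]
    {s : Finset ι} {X d : ι → L} (hX : Set.InjOn X s)
    (h : ∀ j < s.card, ∑ i ∈ s, d i * X i ^ j = 0) {i : ι} (hi : i ∈ s) : d i = 0 := by
  have := Matrix.eq_zero_of_forall_pow_sum_mul_pow_eq_zero (n := s.card)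
    (f := fun l => X (s.equivFin.symm l)) (v := fun l => d (s.equivFin.symm l))
    (fun l l' hl => s.equivFin.symm.injective (Subtype.ext (hX (Subtype.prop _) (Subtype.prop _) hl)))
    (fun j => by
      rw [← h j j.2, ← Finset.sum_coe_sort s]
      exact Fintype.sum_equiv s.equivFin.symm _ _ fun _ => rfl)
  have h1 := congrFun this (s.equivFin ⟨i, hi⟩)
  simpa using h1

section

open scoped Pointwise

variable {B G : Type*} [CommRing B] [Group G] [Finite G]
  [MulSemiringAction G B]

/-- Approximation: an element that is `1` at `w` and highly divisible by the conjugates of `w`. -/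
theorem exists_one_at_prime (G : Type*) [Group G] [Finite G] [MulSemiringAction G B]
    (w : Ideal B) [w.IsMaximal] (n : ℕ) :
    ∃ ε : B, (∀ g ∈ MulAction.stabilizer G w, g • ε - 1 ∈ w) ∧
      ∀ g ∉ MulAction.stabilizer G w, g • ε ∈ w ^ n := by
  classical
  have := Fintype.ofFinite G
  have hcop : IsCoprime w (∏ g : G with g ∉ MulAction.stabilizer G w, (g⁻¹ • w) ^ n) := by
    refine IsCoprime.prod_right fun g hg => IsCoprime.pow_right ?_
    have hg' := (Finset.mem_filter.1 hg).2
    have hmax : (g⁻¹ • w).IsMaximal := by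
      rw [Ideal.pointwise_smul_eq_comap]
      exact Ideal.comap_isMaximal_of_surjective _ (RingEquiv.surjective _)
    rw [Ideal.isCoprime_iff_sup_eq]
    refine Ideal.IsMaximal.coprime_of_ne ‹_› hmax fun h => hg' ?_
    rw [MulAction.mem_stabilizer_iff, ← eq_inv_smul_iff]
    exact h
  obtain ⟨i, hi, j, hj, hij⟩ := Ideal.isCoprime_iff_exists.1 hcop
  refine ⟨j, fun g hg => ?_, fun g hg => ?_⟩
  · rw [← neg_mem_iff, neg_sub, ← smul_one g, ← smul_sub, ← hij, add_sub_cancel_right]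
    exact smul_mem_of_mem_stabilizer hg hi
  · have h1 : j ∈ (g⁻¹ • w) ^ n := (Ideal.prod_le_inf.trans
      (Finset.inf_le (Finset.mem_filter.2 ⟨Finset.mem_univ g, hg⟩))) hj
    refine smul_mem_pow (fun x hx => ?_) h1
    rwa [Ideal.mem_inv_pointwise_smul_iff] at hx

theorem pow_sub_pow_mem {w : Ideal B} {x y : B} (hx : x ∈ w) (hxy : x - y ∈ w ^ 2) (j : ℕ) :
    x ^ j - y ^ j ∈ w ^ (j + 1) := by
  have hy : y ∈ w := by
    have := sub_mem hx (Ideal.pow_le_self two_ne_zero hxy)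
    rwa [sub_sub_cancel] at this
  induction j with
  | zero => simp
  | succ j ih =>
    have h1 := Ideal.mul_mem_mul ih hx
    have h2 := Ideal.mul_mem_mul (Ideal.pow_mem_pow hy j) hxy
    rw [← pow_add] at h2
    rw [← pow_succ] at h1
    have := add_mem h1 h2
    convert! this using 1
    ring

theorem pow_notMem_pow_succ [IsDedekindDomain B] {w : Ideal B} [w.IsPrime] (hw : w ≠ ⊥) {a : B}
    (ha : a ∈ w) (ha2 : a ∉ w ^ 2) (j : ℕ) : a ^ j ∉ w ^ (j + 1) := by
  obtain ⟨I, hI⟩ := Ideal.dvd_iff_le.2 ((Ideal.span_singleton_le_iff_mem w).2 ha)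
  intro h
  have h1 : w ^ j * w ∣ w ^ j * I ^ j := by
    rw [← pow_succ, ← mul_pow, ← hI, Ideal.span_singleton_pow, Ideal.dvd_span_singleton]
    exact h
  have h2 : w ∣ I := (Ideal.prime_of_isPrime hw ‹_›).dvd_of_dvd_pow
    ((mul_dvd_mul_iff_left (pow_ne_zero j hw)).1 h1)
  apply ha2
  rw [← Ideal.dvd_span_singleton, hI, pow_two]
  exact mul_dvd_mul_left w h2

theorem mem_of_pow_mul_mem [IsDedekindDomain B] {w : Ideal B} [w.IsPrime] (hw : w ≠ ⊥) {a c : B}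
    (ha : a ∈ w) (ha2 : a ∉ w ^ 2) {j : ℕ} (h : a ^ j * c ∈ w ^ (j + 1)) : c ∈ w :=
  Ideal.mem_prime_of_mul_mem_pow hw (pow_notMem_pow_succ hw ha ha2 j) h

end

section Tame

open scoped Pointwise

variable {B : Type*} [CommRing B] [IsDedekindDomain B]

/-- Inertia acts trivially on the residue ring, so there the cocycle χ is multiplicative modulo `w`,
with trivial kernel. -/
theorem tame_character_injOn {B G : Type*} [CommRing B] [Group G] [MulSemiringAction G B] {w : Ideal B}
    [w.IsPrime] {χ : G → B}
    (hmul : ∀ g ∈ MulAction.stabilizer G w, ∀ h ∈ MulAction.stabilizer G w,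
      g • χ h * χ g - χ (g * h) ∈ w)
    (hunit : ∀ g ∈ MulAction.stabilizer G w, χ g ∉ w)
    (hinj : ∀ g ∈ w.inertia G, χ g - 1 ∈ w → g = 1) :
    Set.InjOn (fun g => Ideal.Quotient.mk w (χ g)) (w.inertia G : Set G) := by
  intro g hg h hh hgh
  rw [Ideal.Quotient.eq] at hgh
  have hgD := Ideal.inertia_le_stabilizer w hg
  have hhD := Ideal.inertia_le_stabilizer w hh
  have h1 := hmul g hgD (g⁻¹ * h) (mul_mem (inv_mem hgD) hhD)
  rw [mul_inv_cancel_left] at h1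
  have h2 := Ideal.mul_mem_right (χ g) _ (hg (χ (g⁻¹ * h)))
  have h3 : (χ (g⁻¹ * h) - 1) * χ g ∈ w := by
    have := sub_mem (sub_mem h1 h2) hgh
    convert! this using 1
    ring
  have h4 := hinj _ (mul_mem (inv_mem hg) hh)
    (((Ideal.IsPrime.mem_or_mem ‹_› h3)).resolve_right (hunit g hgD))
  rwa [inv_mul_eq_one] at h4

theorem card_le_of_pow_eq_self {L ι : Type*} [CommRing L] [IsDomain L] {Q : ℕ} (hQ : 1 < Q)
    {F : ι → L} (hF : Function.Injective F) (h : ∀ i, F i ^ Q = F i) : Nat.card ι ≤ Q := by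
  have hdeg : (X ^ Q - X : L[X]).natDegree = Q := by
    rw [natDegree_sub_eq_left_of_natDegree_lt] <;> simp [hQ]
  have hne : (X ^ Q - X : L[X]) ≠ 0 := fun h0 => by
    rw [h0, natDegree_zero] at hdeg
    omega
  have hmem : ∀ i, F i ∈ (X ^ Q - X : L[X]).rootSet L := fun i => by
    rw [mem_rootSet_of_ne hne]
    simp [h]
  have hinj : Function.Injective fun i => (⟨F i, hmem i⟩ : (X ^ Q - X : L[X]).rootSet L) :=
    fun i j hij => hF (congrArg Subtype.val hij)
  have h1 := Nat.card_le_card_of_injective _ hinj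
  rw [Nat.card_coe_set_eq] at h1
  have h2 := ncard_rootSet_le (X ^ Q - X : L[X]) L
  rw [hdeg] at h2
  exact h1.trans h2

/-- In a tame abelian extension, the order of the inertia group is at most the size of the residue
field. -/
theorem card_inertia_le (A : Type*) [CommRing A] [IsDedekindDomain A] [Algebra A B]
    [Module.Finite A B] {G : Type*} [CommGroup G] [Finite G] [MulSemiringAction G B]
    [IsGaloisGroup G A B] {w : Ideal B} [w.IsMaximal] [Finite (B ⧸ w)]
    (hw : w ≠ ⊥) (hI : (Nat.card (w.inertia G) : B) ∉ w) {φ : G}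
    (hφD : φ ∈ MulAction.stabilizer G w) {Q : ℕ} (hQ : 1 < Q) (hφ : ∀ x : B, φ • x - x ^ Q ∈ w) :
    Nat.card (w.inertia G) ≤ Q := by
  classical
  obtain ⟨a, -, -, χ, -, hmul, hunit, hinj⟩ := exists_tame_character A hw hI
  have hroot : ∀ g ∈ w.inertia G, χ g ^ Q - χ g ∈ w := by
    intro g hg
    have hgD := Ideal.inertia_le_stabilizer w hg
    have h1 := hmul φ hφD g hgD
    have h2 := hmul g hgD φ hφD
    rw [mul_comm φ g] at h1
    have h3 := Ideal.mul_mem_right (χ g) _ (hg (χ φ))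
    -- Comparing the cocycle relation for φg and gφ, which agree as `G` is abelian, shows that
    -- Frobenius fixes χ(g) modulo `w`.
    have h4 : (φ • χ g - χ g) * χ φ ∈ w := by
      have := add_mem (sub_mem h1 h2) h3
      convert! this using 1
      ring
    have h5 := (Ideal.IsPrime.mem_or_mem inferInstance h4).resolve_right (hunit φ hφD)
    have := sub_mem h5 (hφ (χ g))
    rwa [sub_sub_sub_cancel_left] at this
  refine card_le_of_pow_eq_self hQ (F := fun g : w.inertia G => Ideal.Quotient.mk w (χ g))
    (fun g h hgh => Subtype.ext (tame_character_injOn hmul hunit hinj g.2 h.2 hgh)) fun g => ?_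
  rw [← map_pow, Ideal.Quotient.eq]
  exact hroot g g.2

/-- The elements of a Galois group are independent modulo a tamely ramified prime. -/
theorem mem_of_sum_mul_smul_mem_pow (A : Type*) [CommRing A] [IsDedekindDomain A] [Algebra A B]
    [Module.Finite A B] {G : Type*} [Group G] [Fintype G] [MulSemiringAction G B]
    [IsGaloisGroup G A B] {w : Ideal B} [w.IsMaximal] [Finite (B ⧸ w)]
    (hw : w ≠ ⊥) (hI : (Nat.card (w.inertia G) : B) ∉ w) {c : G → B}
    (hc : ∀ y : B, ∑ g, c g * g • y ∈ w ^ Nat.card (w.inertia G)) : c 1 ∈ w := by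
  classical
  obtain ⟨a, ha, ha2, χ, hχ, hmul, hunit, hinj⟩ := exists_tame_character A hw hI
  set e := Nat.card (w.inertia G) with he
  obtain ⟨ε, hε, hε'⟩ := exists_one_at_prime G w e
  let D := MulAction.stabilizer G w
  -- Insert y = ε a^j z. Terms outside `D` die modulo w^(j+1), those in `D` become c(g) χ(g)^j a^j ·
  -- g z, and a^j cancels. The bound j < e is what the hypothesis modulo w^e allows.
  have step : ∀ j < e, ∀ z : B, ∑ g : D, c g * χ g ^ j * g • z ∈ w := by
    intro j hj z
    apply mem_of_pow_mul_mem hw ha ha2 (j := j)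
    have hle : w ^ e ≤ w ^ (j + 1) := Ideal.pow_le_pow_right hj
    have h1 := hle (hc (ε * a ^ j * z))
    rw [← Finset.sum_filter_add_sum_filter_not _ (fun g => g ∈ D)] at h1
    have h2 : ∑ g with g ∉ D, c g * g • (ε * a ^ j * z) ∈ w ^ (j + 1) := by
      refine Submodule.sum_mem _ fun g hg => ?_
      rw [smul_mul', smul_mul', mul_assoc]
      exact Ideal.mul_mem_left _ _ (Ideal.mul_mem_right _ _
        (hle (hε' g (Finset.mem_filter.1 hg).2)))
    have h3 := (add_mem_cancel_right h2).1 h1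
    rw [Finset.sum_subtype (p := fun g => g ∈ D) _ (by simp)] at h3
    rw [Finset.mul_sum]
    have h4 : ∑ g : D, c g * g.1 • (ε * a ^ j * z) - ∑ g : D, a ^ j * (c g * χ g ^ j * g • z) ∈
        w ^ (j + 1) := by
      rw [← Finset.sum_sub_distrib]
      refine Submodule.sum_mem _ fun g _ => ?_
      have h5 := pow_sub_pow_mem (smul_mem_of_mem_stabilizer g.2 ha) (hχ g g.2) j
      have h6 := Ideal.mul_mem_mul
        (Ideal.pow_mem_pow (smul_mem_of_mem_stabilizer g.2 ha) j) (hε g g.2)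
      rw [← pow_succ] at h6
      have h7 := Ideal.mul_mem_left _ (c g * g.1 • z) (add_mem h6 h5)
      convert! h7 using 1
      rw [smul_mul', smul_mul', smul_pow']
      change _ - a ^ j * (c g * χ g ^ j * g.1 • z) = _
      ring
    have h5 := sub_mem h3 h4
    rwa [sub_sub_cancel] at h5
  let ψ : D → B →* B ⧸ w := fun g =>
    ((Ideal.Quotient.mk w).comp (MulSemiringAction.toRingHom G B g) : B →+* B ⧸ w)
  let f : B →* B ⧸ w := (Ideal.Quotient.mk w : B →+* B ⧸ w)
  have hψ : ∀ g : D, ψ g = f ↔ g.1 ∈ w.inertia G := by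
    intro g
    rw [DFunLike.ext_iff]
    exact forall_congr' fun x => Ideal.Quotient.eq
  let s : Finset D := Finset.univ.filter fun g => ψ g = f
  have hs : s.card = e := by
    rw [he, ← Nat.card_eq_finsetCard]
    refine Nat.card_congr ⟨fun g => ⟨g.1.1, (hψ g.1).1 (Finset.mem_filter.1 g.2).2⟩,
      fun g => ⟨⟨g.1, Ideal.inertia_le_stabilizer w g.2⟩,
        Finset.mem_filter.2 ⟨Finset.mem_univ _, (hψ _).2 g.2⟩⟩, fun _ => rfl, fun _ => rfl⟩
  -- The fibre over the reduction map is inertia. Its e elements have distinct χ-values and satisfy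
  -- e power-sum equations, so Vandermonde applies.
  have hzero : ∀ j < s.card, ∑ g ∈ s, Ideal.Quotient.mk w (c g) * Ideal.Quotient.mk w (χ g) ^ j = 0 := by
    intro j hj
    refine sum_fiber_eq_zero_of_monoidHom ψ
      (fun g => Ideal.Quotient.mk w (c g) * Ideal.Quotient.mk w (χ g) ^ j) (fun z => ?_) f
    have := Ideal.Quotient.eq_zero_iff_mem.2 (step j (hs ▸ hj) z)
    rw [map_sum] at this
    refine Eq.trans (Finset.sum_congr rfl fun g _ => ?_) this
    rw [map_mul, map_mul, map_pow]
    rfl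
  have h1 := eq_zero_of_forall_sum_mul_pow_eq_zero (i := (1 : D)) ?_ hzero
    (Finset.mem_filter.2 ⟨Finset.mem_univ _, (hψ 1).2 (one_mem _)⟩)
  · exact Ideal.Quotient.eq_zero_iff_mem.1 h1
  · intro g hg h hh hgh
    exact Subtype.ext (tame_character_injOn hmul hunit hinj
      ((hψ g).1 (Finset.mem_filter.1 hg).2) ((hψ h).1 (Finset.mem_filter.1 hh).2) hgh)

/-- In a tame abelian extension, the `Q`-power map is congruent to the Frobenius followed by the
projector onto the invariants of inertia. -/
theorem frobenius_sub_pow_mem (A : Type*) [CommRing A] [IsDedekindDomain A] [Algebra A B]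
    [Module.Finite A B] {G : Type*} [CommGroup G] [Finite G] [MulSemiringAction G B]
    [IsGaloisGroup G A B] {w : Ideal B} [w.IsMaximal] [Finite (B ⧸ w)] [Fintype (w.inertia G)]
    (hw : w ≠ ⊥) {i : B} (hi : i * Nat.card (w.inertia G) = 1) (hiG : ∀ g : G, g • i = i) {φ : G}
    (hφD : φ ∈ MulAction.stabilizer G w) {Q : ℕ} (hQ : 1 < Q) (hφ : ∀ x : B, φ • x - x ^ Q ∈ w)
    (hadd : ∀ x y : B, (x + y) ^ Q = x ^ Q + y ^ Q) (x : B) :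
    i * ∑ g : w.inertia G, (g.1 * φ) • x - x ^ Q ∈ w ^ Nat.card (w.inertia G) := by
  have hI : (Nat.card (w.inertia G) : B) ∉ w := fun h => by
    have := Ideal.mul_mem_left w i h
    rw [hi] at this
    exact (Ideal.ne_top_iff_one w).1 (Ideal.IsMaximal.ne_top ‹_›) this
  have hle := card_inertia_le A hw hI hφD hQ hφ
  set e := Nat.card (w.inertia G) with he
  have hcomm : ∀ y : B, ∑ g : w.inertia G, (g.1 * φ) • y = φ • ∑ g : w.inertia G, g.1 • y := by
    intro y
    rw [Finset.smul_sum]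
    exact Finset.sum_congr rfl fun g _ => by rw [mul_comm, mul_smul]
  have hconst : ∀ y : B, ∑ _g : w.inertia G, y = e * y := fun y => by
    rw [Finset.sum_const, Finset.card_univ, ← Nat.card_eq_fintype_card, nsmul_eq_mul]
  set x₀ := i * ∑ g : w.inertia G, g.1 • x with hx₀
  have hfix : ∀ g ∈ w.inertia G, g • x₀ = x₀ := by
    intro g hg
    rw [hx₀, smul_mul', hiG, Finset.smul_sum]
    congr 1
    exact Fintype.sum_equiv (Equiv.mulLeft (⟨g, hg⟩ : w.inertia G)) _ _
      fun h => (mul_smul g h.1 x).symm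
  have hsum₀ : ∑ g : w.inertia G, g.1 • x₀ = e * x₀ := by
    rw [← hconst]
    exact Finset.sum_congr rfl fun g _ => hfix g.1 g.2
  have hx₀w : x - x₀ ∈ w := by
    have h1 : x - x₀ = -(i * ∑ g : w.inertia G, (g.1 • x - x)) := by
      rw [Finset.sum_sub_distrib, hconst, mul_sub, ← mul_assoc, hi, hx₀]
      ring
    rw [h1, neg_mem_iff]
    exact Ideal.mul_mem_left _ _ (Submodule.sum_mem _ fun g _ => g.2 x)
  have h0 : φ • x₀ - x₀ ^ Q ∈ w ^ e := by
    refine mem_pow_card_of_fixed A hw le_rfl (hφ x₀) fun g hg => ?_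
    rw [smul_sub, smul_pow', hfix g hg, ← mul_smul, mul_comm g, mul_smul, hfix g hg]
  have h1 : (x - x₀) ^ Q ∈ w ^ e := Ideal.pow_le_pow_right hle (Ideal.pow_mem_pow hx₀w Q)
  have h2 : i * ∑ g : w.inertia G, (g.1 * φ) • x = φ • x₀ := by
    rw [hcomm, hx₀, smul_mul', hiG]
  have h3 : x ^ Q = x₀ ^ Q + (x - x₀) ^ Q := by rw [← hadd, add_sub_cancel]
  rw [h2, h3, ← sub_sub]
  exact sub_mem h0 h1

end Tame


/-! ### Passage from one prime to all primes above v -/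

section

open scoped Pointwise

theorem finite_quotient_of_liesOver {A B : Type*} [CommRing A] [CommRing B] [Algebra A B]
    [Module.Finite A B] {v : Ideal A} [Finite (A ⧸ v)] (w : Ideal B) [w.LiesOver v] :
    Finite (B ⧸ w) :=
  Module.finite_of_finite (A ⧸ v)

variable {A B G : Type*} [CommRing A] [CommRing B] [IsDedekindDomain A] [IsDedekindDomain B]
  [Algebra A B] [Module.Finite A B] [Module.IsTorsionFree A B]

theorem card_inertia_eq_ramificationIdx [Group G] [Finite G] [MulSemiringAction G B]
    [IsGaloisGroup G A B] {v : Ideal A} [v.IsMaximal] [Finite (A ⧸ v)] (w : Ideal B) [w.IsPrime]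
    [w.LiesOver v] : Nat.card (w.inertia G) = w.ramificationIdx A := by
  rw [Ideal.card_inertia_eq_ramificationIdxIn (G := G) v w,
    Ideal.ramificationIdxIn_eq_ramificationIdx v w G]

/-- Membership in `vB` can be tested at the primes above `v`. -/
theorem mem_map_iff_forall_mem_pow {v : Ideal A} [v.IsMaximal] (hv : v ≠ ⊥) {x : B} :
    x ∈ v.map (algebraMap A B) ↔
      ∀ w : Ideal B, w.IsPrime → w.LiesOver v → x ∈ w ^ w.ramificationIdx A := by
  constructor
  · intro hx w hw hwv
    rw [← Ideal.ramificationIdx'_eq_ramificationIdx v w hv]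
    exact Ideal.le_pow_ramificationIdx' hx
  · intro h
    rw [Ideal.map_algebraMap_eq_finsetProd_pow hv]
    rw [← IsDedekindDomain.inf_pow_eq_prod_of_prime _ (fun P : Ideal B => P) _ (fun P hP => ?_)
      (fun P _ Q _ hPQ => hPQ), Submodule.mem_finsetInf]
    · intro P hP
      have hP' := Set.mem_toFinset.1 hP
      exact h P hP'.1 hP'.2
    · have hP' := Set.mem_toFinset.1 hP
      have := hP'.1
      have := hP'.2
      exact Ideal.prime_of_isPrime (Ideal.ne_bot_of_liesOver_of_ne_bot hv P) hP'.1

/-- The elements of the Galois group act independently on `B / vB`. -/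
theorem mem_of_sum_smul_mem_map [Group G] [Fintype G] [MulSemiringAction G B]
    [IsGaloisGroup G A B] {v : Ideal A} [v.IsMaximal] [Finite (A ⧸ v)] (hv : v ≠ ⊥)
    {w : Ideal B} [w.IsMaximal] [w.LiesOver v] (hI : (Nat.card (w.inertia G) : B) ∉ w)
    {c : G → A} (hc : ∀ y : B, ∑ g, c g • g • y ∈ v.map (algebraMap A B)) (h : G) : c h ∈ v := by
  have := finite_quotient_of_liesOver (v := v) w
  have hw : w ≠ ⊥ := Ideal.ne_bot_of_liesOver_of_ne_bot hv w
  -- Translating by `h` moves its coefficient to the identity.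
  have h1 := mem_of_sum_mul_smul_mem_pow A hw hI (c := fun g => algebraMap A B (c (g * h)))
    (fun y => by
      rw [card_inertia_eq_ramificationIdx (A := A) (v := v) w]
      refine (mem_map_iff_forall_mem_pow hv).1 ?_ w inferInstance inferInstance
      convert! hc (h⁻¹ • y) using 1
      refine Fintype.sum_equiv (Equiv.mulRight h) _ _ fun g => ?_
      rw [Equiv.coe_mulRight, mul_smul, smul_inv_smul, Algebra.smul_def])
  rw [one_mul] at h1
  rw [Ideal.LiesOver.over (P := w) (p := v)]
  exact h1

theorem frobenius_sub_pow_mem_map [CommGroup G] [Finite G] [MulSemiringAction G B]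
    [IsGaloisGroup G A B] {v : Ideal A} [v.IsMaximal] [Finite (A ⧸ v)] (hv : v ≠ ⊥)
    {w : Ideal B} [w.IsMaximal] [w.LiesOver v] [Fintype (w.inertia G)]
    {i : A} (hi : i * Nat.card (w.inertia G) = 1) {φ : G} (hφ : IsArithFrobAt A φ w)
    (hadd : ∀ x y : B, (x + y) ^ Nat.card (A ⧸ v) = x ^ Nat.card (A ⧸ v) + y ^ Nat.card (A ⧸ v))
    (x : B) :
    i • ∑ g : w.inertia G, (g.1 * φ) • x - x ^ Nat.card (A ⧸ v) ∈ v.map (algebraMap A B) := by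
  have := finite_quotient_of_liesOver (v := v) w
  have hw : w ≠ ⊥ := Ideal.ne_bot_of_liesOver_of_ne_bot hv w
  have hover : v = w.under A := Ideal.LiesOver.over
  have key : ∀ x : B, i • ∑ g : w.inertia G, (g.1 * φ) • x - x ^ Nat.card (A ⧸ v) ∈
      w ^ w.ramificationIdx A := fun x => by
    rw [← card_inertia_eq_ramificationIdx (A := A) (G := G) (v := v) w, Algebra.smul_def]
    refine frobenius_sub_pow_mem A hw ?_ (fun g => ?_) hφ.mem_stabilizer Finite.one_lt_card
      (fun y => ?_) hadd x
    · rw [← map_natCast (algebraMap A B), ← map_mul, hi, map_one]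
    · rw [smul_algebraMap]
    · have := hφ y
      rwa [← hover] at this
  rw [mem_map_iff_forall_mem_pow hv]
  intro w' hw' hw'v
  -- Conjugating by `g` carries the congruence at `w` to g • w, and commutativity leaves the
  -- operator unchanged.
  obtain ⟨g, rfl⟩ := Ideal.exists_smul_eq_of_isGaloisGroup v w w' G
  rw [Ideal.ramificationIdx_smul]
  have h1 := smul_mem_pow (w' := g • w) (g := g)
    (fun y hy => Ideal.smul_mem_pointwise_smul g y w hy) (key (g⁻¹ • x))
  convert! h1 using 1
  have h2 : ∀ h : w.inertia G, g • (h.1 * φ) • g⁻¹ • x = (h.1 * φ) • x := fun h => by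
    rw [← mul_smul, ← mul_smul, mul_comm g, mul_assoc, mul_inv_cancel, mul_one]
  have h3 : g • ∑ h : w.inertia G, (h.1 * φ) • g⁻¹ • x = ∑ h : w.inertia G, (h.1 * φ) • x := by
    rw [Finset.smul_sum]
    exact Finset.sum_congr rfl fun h _ => h2 h
  rw [smul_sub, smul_pow', smul_inv_smul, smul_comm g i, h3]

end


/-! ### Semilinear maps on group algebras of finite fields -/

section GroupAlgebra

open MonoidAlgebra
open scoped AlgebraMonoidAlgebra

variable (k κ G : Type*) [Field k] [Fintype k] [Field κ] [Finite κ] [Algebra k κ]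
  [CommGroup G] [Finite G]

/-- The `q`-Frobenius on the coefficients of `κ[G]`. -/
noncomputable def coeffFrob : MonoidAlgebra κ G →ₐ[MonoidAlgebra k G] MonoidAlgebra κ G where
  __ := mapRingHom G (FiniteField.frobeniusAlgHom k κ : κ →+* κ)
  commutes' r := by
    change mapRingHom G _ (mapRingHom G _ r) = mapRingHom G _ r
    ext g
    simp only [coeff_mapRingHom]
    exact AlgHom.commutes (FiniteField.frobeniusAlgHom k κ) _

theorem coeffFrob_coeff (x : MonoidAlgebra κ G) (g : G) :
    (coeffFrob k κ G x).coeff g = x.coeff g ^ Fintype.card k :=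
  coeff_mapRingHom _ _ _

variable {k κ} in
/-- A basis of `κ` over `k` is a basis of `κ[G]` over `k[G]`. -/
noncomputable def groupAlgebraBasis {ι : Type*} [Fintype ι] (β : Module.Basis ι k κ) :
    Module.Basis ι (MonoidAlgebra k G) (MonoidAlgebra κ G) :=
  have hcoeff : ∀ (c : ι → MonoidAlgebra k G) (g : G),
      (∑ i, c i • single (1 : G) (β i)).coeff g = ∑ i, (c i).coeff g • β i := by
    intro c g
    rw [MonoidAlgebra.coeff_sum, Finsupp.finsetSum_apply]
    refine Finset.sum_congr rfl fun i _ => ?_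
    rw [Algebra.smul_def, MonoidAlgebra.algebraMap_def, coeff_mul_single_one, coeff_mapRingHom, Algebra.smul_def]
  Module.Basis.mk (v := fun i => single (1 : G) (β i)) (by
    rw [Fintype.linearIndependent_iff]
    intro c hc i
    ext g
    have h1 := hcoeff c g
    rw [hc] at h1
    exact Fintype.linearIndependent_iff.1 β.linearIndependent _ h1.symm i) (by
    intro x _
    rw [Submodule.mem_span_range_iff_exists_fun]
    refine ⟨fun i => .ofCoeff (Finsupp.equivFunOnFinite.symm fun g => β.repr (x.coeff g) i), ?_⟩
    ext g
    rw [hcoeff]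
    exact β.sum_repr (x.coeff g))

theorem groupAlgebraBasis_apply {ι : Type*} [Fintype ι] (β : Module.Basis ι k κ) (i : ι) :
    groupAlgebraBasis G β i = single 1 (β i) := by
  rw [groupAlgebraBasis, Module.Basis.mk_apply]

theorem coeffFrob_pow_coeff (j : ℕ) (x : MonoidAlgebra κ G) (g : G) :
    ((coeffFrob k κ G ^ j) x).coeff g = (FiniteField.frobeniusAlgHom k κ ^ j) (x.coeff g) := by
  induction j generalizing x with
  | zero => rfl
  | succ j ih =>
    rw [pow_succ, AlgHom.mul_apply, ih, coeffFrob_coeff, pow_succ]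
    rfl

theorem coeffFrob_pow_single (j : ℕ) (c : κ) (g : G) :
    (coeffFrob k κ G ^ j) (single g c) = single g ((FiniteField.frobeniusAlgHom k κ ^ j) c) := by
  classical
  ext h
  rw [coeffFrob_pow_coeff, MonoidAlgebra.coeff_single, MonoidAlgebra.coeff_single, Finsupp.single_apply,
    Finsupp.single_apply, apply_ite (FiniteField.frobeniusAlgHom k κ ^ j), map_zero]

theorem coeffFrob_pow_finrank : coeffFrob k κ G ^ Module.finrank k κ = 1 := by
  refine AlgHom.ext fun x => ?_
  ext g
  rw [coeffFrob_pow_coeff, ← FiniteField.orderOf_frobeniusAlgHom, pow_orderOf_eq_one]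
  rfl

-- A linear dependence between the columns of the Moore matrix would be one between distinct powers
-- of Frobenius, which are independent as characters.
open Matrix in
theorem det_frobenius_basis_ne_zero (β : Module.Basis (Fin (Module.finrank k κ)) k κ) :
    (of fun i j => (FiniteField.frobeniusAlgHom k κ ^ (j : ℕ)) (β i) :
      Matrix (Fin (Module.finrank k κ)) (Fin (Module.finrank k κ)) κ).det ≠ 0 := by
  rw [Ne, ← exists_mulVec_eq_zero_iff]
  rintro ⟨c, hc0, hc⟩
  apply hc0
  have hli := (linearIndependent_algHom_toLinearMap k κ κ).comp _
    (FiniteField.bijective_frobeniusAlgHom_pow k κ).1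
  have := Fintype.linearIndependent_iff.1 hli c (β.ext fun i => by
    rw [LinearMap.zero_apply, ← Pi.zero_apply (M := fun _ => κ) i, ← hc, LinearMap.sum_apply]
    refine Finset.sum_congr rfl fun j _ => ?_
    exact mul_comm _ _)
  exact funext this

open Matrix in
/-- The characteristic polynomial over `k[G]` of `x ↦ t x + Fr(x) u` on `κ[G]`. -/
theorem charpoly_groupAlgebra (β : Module.Basis (Fin (Module.finrank k κ)) k κ) (t : κ)
    (u : MonoidAlgebra κ G) (f : MonoidAlgebra κ G →ₗ[MonoidAlgebra k G] MonoidAlgebra κ G)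
    (hf : ∀ x, f x = single 1 t * x + coeffFrob k κ G x * u) :
    (LinearMap.toMatrix (groupAlgebraBasis G β) (groupAlgebraBasis G β) f).charpoly.map
      (mapRingHom G (algebraMap k κ)) =
    (Algebra.leftMulMatrix β t).charpoly.map
      ((mapRingHom G (algebraMap k κ)).comp (algebraMap k (MonoidAlgebra k G))) -
      C (∏ j : Fin (Module.finrank k κ), (coeffFrob k κ G ^ (j : ℕ)) u) := by
  have : NeZero (Module.finrank k κ) := ⟨Module.finrank_pos.ne'⟩
  have hdet := (det_frobenius_basis_ne_zero k κ β).isUnit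
  have h1 := charpoly_add_semilinear (groupAlgebraBasis G β) (coeffFrob k κ G)
    (coeffFrob_pow_finrank k κ G) (by
      have h2 := hdet.map (singleOneRingHom (R := κ) (M := G))
      rw [RingHom.map_det] at h2
      convert! h2 using 2
      ext1 i j
      rw [Matrix.of_apply, groupAlgebraBasis_apply, coeffFrob_pow_single]
      rfl) (single 1 t) u f hf
  -- The same formula over κ with u = 0 identifies ∏(X − t^(q^j)) with the characteristic polynomial
  -- of multiplication by `t`.
  have h2 := charpoly_add_semilinear β (FiniteField.frobeniusAlgHom k κ)
    (by rw [← FiniteField.orderOf_frobeniusAlgHom, pow_orderOf_eq_one]) hdet t 0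
    (LinearMap.mulLeft k t) (by simp)
  rw [MonoidAlgebra.algebraMap_def] at h1
  rw [h1]
  congr 1
  have h3 : (mapRingHom G (algebraMap k κ)).comp (algebraMap k (MonoidAlgebra k G)) =
      (singleOneRingHom (R := κ) (M := G)).comp (algebraMap k κ) := by
    ext c
    simp
  have h4 : Algebra.leftMulMatrix β t = LinearMap.toMatrix β β (LinearMap.mulLeft k t) := rfl
  rw [h3, ← Polynomial.map_map, h4, h2]
  have h5 : ∏ j : Fin (Module.finrank k κ),
      (FiniteField.frobeniusAlgHom k κ ^ (j : ℕ)) (0 : κ) = 0 :=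
    Finset.prod_eq_zero (Finset.mem_univ 0) (map_zero _)
  rw [h5, C_0, sub_zero, Polynomial.map_prod]
  refine Finset.prod_congr rfl fun j _ => ?_
  rw [Polynomial.map_sub, map_X, map_C, coeffFrob_pow_single]
  rfl

end GroupAlgebra


/-! ### Transport of t and τ along a normal basis -/

section ResidueAlgebra

open scoped AlgebraMonoidAlgebra

variable {k R κ S G : Type*} [Field k] [Fintype k] [CommRing R] [Algebra k R]
  [Field κ] [Finite κ] [Algebra k κ] [CommRing S] [Algebra R S] [Algebra k S] [IsScalarTower k R S]
  [Algebra κ S] [IsScalarTower k κ S] [CommGroup G] [Finite G]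

theorem twistedAction_C (ρ : AlgAction G R S) (x : R) :
    twistedAction ρ (SkewPolynomial.C (toTwist k R x)) = mulEnd k ρ x := by
  change SkewMonoidAlgebra.liftNC _ _ (SkewMonoidAlgebra.single _ _) = _
  rw [SkewMonoidAlgebra.liftNC_single, map_one, mul_one]
  rfl

theorem twistedAction_X (ρ : AlgAction G R S) :
    twistedAction ρ (SkewPolynomial.X : TwistedPoly k R) = frobEnd k ρ := by
  change SkewMonoidAlgebra.liftNC _ _ (SkewMonoidAlgebra.single _ _) = _
  rw [SkewMonoidAlgebra.liftNC_single]
  change ((mulEnd k ρ).comp ((toTwist k R).symm : Twist k R →+* R)) 1 * frobEnd k ρ ^ 1 = _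
  rw [map_one, one_mul, pow_one]

theorem twistedAction_carlitz [Algebra k[X] R] [Nontrivial R] (ρ : AlgAction G R S) :
    twistedAction ρ ((carlitz k R).φ X) = mulEnd k ρ (algebraMap k[X] R X) + frobEnd k ρ := by
  change twistedAction ρ (aeval _ X) = _
  rw [aeval_X, map_add, twistedAction_C, twistedAction_X]

variable (ρ : AlgAction G R S) (hρ : ∀ g (α : κ) x, ρ g (α • x) = α • ρ g x)
  (b : Module.Basis G κ S) (hb : ∀ g, b g = ρ g (b 1))

/-- The evaluation `κ[G] → S` at a normal basis. -/
noncomputable def evalNormal (b : Module.Basis G κ S) : MonoidAlgebra κ G ≃+ S :=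
  MonoidAlgebra.coeffAddEquiv.trans b.repr.symm.toAddEquiv

theorem evalNormal_single (g : G) (α : κ) :
    evalNormal b (MonoidAlgebra.single g α) = α • b g :=
  b.repr_symm_single g α

include hρ hb in
theorem evalNormal_single_mul (g : G) (α : κ) (x : MonoidAlgebra κ G) :
    evalNormal b (MonoidAlgebra.single g α * x) = α • ρ g (evalNormal b x) := by
  induction x using MonoidAlgebra.induction_linear with
  | zero => simp
  | add x y hx hy => rw [mul_add, map_add, hx, hy, map_add, map_add, smul_add]
  | single h β =>
    rw [MonoidAlgebra.single_mul_single, evalNormal_single, evalNormal_single, hρ, hb (g * h),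
      hb h, map_mul, mul_smul]
    rfl

include hρ hb in
theorem evalNormal_smul (r : MonoidAlgebra k G) (x : MonoidAlgebra κ G) :
    evalNormal b (r • x) = (rep k ρ).asAlgebraHom r (evalNormal b x) := by
  induction r using MonoidAlgebra.induction_linear with
  | zero => simp
  | add r s hr hs => rw [add_smul, map_add, hr, hs, map_add]; rfl
  | single g c =>
    rw [Algebra.smul_def, MonoidAlgebra.algebraMap_def, MonoidAlgebra.mapRingHom_single,
      evalNormal_single_mul ρ hρ b hb, Representation.asAlgebraHom_single, algebraMap_smul]
    rfl

include hρ hb in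
theorem evalNormal_pow (x : MonoidAlgebra κ G) :
    evalNormal b x ^ Fintype.card k =
      evalNormal b (coeffFrob k κ G x * (evalNormal b).symm (b 1 ^ Fintype.card k)) := by
  induction x using MonoidAlgebra.induction_linear with
  | zero => simp
  | add x y hx hy =>
    rw [map_add, map_add, add_mul, map_add, ← hx, ← hy]
    exact map_add (FiniteField.frobeniusAlgHom k S) _ _
  | single g α =>
    have h := coeffFrob_pow_single k κ G 1 α g
    rw [pow_one, pow_one] at h
    rw [h, evalNormal_single_mul ρ hρ b hb, evalNormal_single, _root_.smul_pow, hb g, ← map_pow,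
      AddEquiv.apply_symm_apply]
    rfl

-- Iterating x ↦ Fr(x)·u from x = 1 accumulates the Frobenius conjugates of u.
include hρ hb in
theorem pow_eq_evalNormal_prod (m : ℕ) :
    b 1 ^ Fintype.card k ^ m = evalNormal b (∏ j : Fin m,
      (coeffFrob k κ G ^ (j : ℕ)) ((evalNormal b).symm (b 1 ^ Fintype.card k))) := by
  rw [Fin.prod_univ_eq_prod_range
    (fun j => (coeffFrob k κ G ^ j) ((evalNormal b).symm (b 1 ^ Fintype.card k))) m]
  induction m with
  | zero =>
    rw [pow_zero, pow_one, Finset.prod_range_zero, MonoidAlgebra.one_def, evalNormal_single,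
      one_smul]
  | succ m ih =>
    rw [pow_succ, pow_mul, ih, evalNormal_pow ρ hρ b hb, Finset.prod_range_succ', map_prod]
    congr 3
    exact funext fun j => by rw [pow_succ', AlgHom.mul_apply]

/-- The residue algebra as a `k[G]`-module is `κ[G]`. -/
noncomputable def evalNormalEquiv :
    MonoidAlgebra κ G ≃ₗ[MonoidAlgebra k G] (rep k ρ).asModule where
  __ := (evalNormal b).trans (rep k ρ).asModuleEquiv.symm.toAddEquiv
  map_smul' r x := evalNormal_smul ρ hρ b hb r x

theorem evalNormalEquiv_apply (x : MonoidAlgebra κ G) :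
    evalNormalEquiv (k := k) ρ hρ b hb x = (rep k ρ).asModuleEquiv.symm (evalNormal b x) := rfl

include hρ hb in
theorem free_finite_finrank_aeval
    (f : Module.End (MonoidAlgebra k G) (rep k ρ).asModule) :
    Module.Free (MonoidAlgebra k G) (Module.AEval' f) ∧
      Module.Finite (MonoidAlgebra k G) (Module.AEval' f) ∧
      Module.finrank (MonoidAlgebra k G) (Module.AEval' f) = Module.finrank k κ := by
  have B := ((groupAlgebraBasis G (Module.finBasis k κ)).map
    (evalNormalEquiv (k := k) ρ hρ b hb)).map (Module.AEval'.of f)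
  refine ⟨.of_basis B, .of_basis B, ?_⟩
  rw [Module.finrank_eq_card_basis B, Fintype.card_fin]

theorem size_aeval_map (f : Module.End (MonoidAlgebra k G) (rep k ρ).asModule) (t : κ)
    (u : MonoidAlgebra κ G)
    (hf : ∀ x, f (evalNormalEquiv ρ hρ b hb x) = evalNormalEquiv ρ hρ b hb
      (MonoidAlgebra.single 1 t * x + coeffFrob k κ G x * u)) :
    (size (MonoidAlgebra k G) (Module.AEval' f)).map
      (MonoidAlgebra.mapRingHom G (algebraMap k κ)) =
    (Algebra.leftMulMatrix (Module.finBasis k κ) t).charpoly.map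
      ((MonoidAlgebra.mapRingHom G (algebraMap k κ)).comp (algebraMap k (MonoidAlgebra k G))) -
      C (∏ j : Fin (Module.finrank k κ), (coeffFrob k κ G ^ (j : ℕ)) u) := by
  set e := evalNormalEquiv (k := k) ρ hρ b hb with he
  set B := groupAlgebraBasis G (Module.finBasis k κ)
  have h1 : LinearMap.toMatrix (B.map e) (B.map e) f =
      LinearMap.toMatrix B B (e.symm.toLinearMap ∘ₗ f ∘ₗ e.toLinearMap) := by
    ext i j
    rw [LinearMap.toMatrix_apply, LinearMap.toMatrix_apply]
    simp
  rw [size_aeval (B.map e), h1]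
  exact charpoly_groupAlgebra k κ G _ t u _ fun x => by
    rw [LinearMap.comp_apply, LinearMap.comp_apply, LinearEquiv.coe_coe, LinearEquiv.coe_coe, hf,
      LinearEquiv.symm_apply_apply]

theorem map_mapRingHom_injective : Function.Injective
    (Polynomial.map (MonoidAlgebra.mapRingHom G (algebraMap k κ))) :=
  Polynomial.map_injective _ (MonoidAlgebra.map_injective _ (algebraMap k κ).injective)

variable [Algebra R κ] [IsScalarTower R κ S]

include hρ hb in
theorem size_mulEnd (a : R) :
    size (MonoidAlgebra k G) (Module.AEval' (mulEnd k ρ a)) =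
      (Algebra.leftMulMatrix (Module.finBasis k κ) (algebraMap R κ a)).charpoly.map
        (algebraMap k (MonoidAlgebra k G)) := by
  apply map_mapRingHom_injective (k := k) (κ := κ)
  rw [size_aeval_map ρ hρ b hb (mulEnd k ρ a) (algebraMap R κ a) 0 (fun x => by
    rw [mul_zero, add_zero, evalNormalEquiv_apply, evalNormalEquiv_apply, mulEnd_apply,
      evalNormal_single_mul ρ hρ b hb, map_one, algebraMap_smul]
    rfl), Polynomial.map_map]
  have : NeZero (Module.finrank k κ) := ⟨Module.finrank_pos.ne'⟩
  have h : ∏ j : Fin (Module.finrank k κ), (coeffFrob k κ G ^ (j : ℕ)) 0 = 0 :=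
    Finset.prod_eq_zero (Finset.mem_univ 0) (map_zero _)
  rw [h, C_0, sub_zero]

-- The product of conjugates of u and the element θ both carry the generator to its q^n-th power, so
-- they agree by injectivity of `evalNormal`.
include hρ hb in
theorem size_mulEnd_add_frobEnd (a : R) (θ : MonoidAlgebra k G)
    (hθ : ∀ s : S, s ^ Fintype.card k ^ Module.finrank k κ = (rep k ρ).asAlgebraHom θ s) :
    size (MonoidAlgebra k G) (Module.AEval' (mulEnd k ρ a + frobEnd k ρ)) =
      (Algebra.leftMulMatrix (Module.finBasis k κ) (algebraMap R κ a)).charpoly.map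
        (algebraMap k (MonoidAlgebra k G)) - C θ := by
  apply map_mapRingHom_injective (k := k) (κ := κ)
  rw [size_aeval_map ρ hρ b hb _ (algebraMap R κ a)
    ((evalNormal b).symm (b 1 ^ Fintype.card k)) (fun x => by
      rw [evalNormalEquiv_apply, evalNormalEquiv_apply, LinearMap.add_apply, mulEnd_apply,
        frobEnd_apply, map_add, map_add, evalNormal_single_mul ρ hρ b hb, map_one, algebraMap_smul,
        evalNormal_pow ρ hρ b hb]
      rfl), Polynomial.map_sub, Polynomial.map_map, map_C]
  congr 2
  apply (evalNormal b).injective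
  rw [← pow_eq_evalNormal_prod ρ hρ b hb, hθ]
  have h := evalNormal_smul ρ hρ b hb θ 1
  rw [Algebra.smul_def, mul_one, MonoidAlgebra.algebraMap_def] at h
  rw [h, MonoidAlgebra.one_def, evalNormal_single, one_smul]

end ResidueAlgebra


/-! ### Nv as a characteristic polynomial -/

section Charpoly

theorem charpoly_blockDiagonal {R m o : Type*} [CommRing R] [Fintype m] [DecidableEq m]
    [Fintype o] [DecidableEq o] (M : o → Matrix m m R) :
    (Matrix.blockDiagonal M).charpoly = ∏ i, (M i).charpoly := by
  have h : (Matrix.blockDiagonal M).charmatrix =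
      Matrix.blockDiagonal fun i => (M i).charmatrix := by
    ext1 ⟨i, a⟩ ⟨j, b⟩
    simp only [Matrix.charmatrix_apply, Matrix.blockDiagonal_apply, Matrix.diagonal_apply,
      Prod.mk.injEq]
    by_cases hab : a = b <;> simp [hab]
  rw [Matrix.charpoly, h, Matrix.det_blockDiagonal]
  rfl

open IntermediateField in
/-- The characteristic polynomial of multiplication by `x` is a power of its minimal polynomial. -/
theorem charpoly_leftMulMatrix_eq_minpoly_pow {k κ ι : Type*} [Field k] [Field κ] [Algebra k κ]
    [FiniteDimensional k κ] [Fintype ι] [DecidableEq ι] (β : Module.Basis ι k κ) (x : κ) :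
    ∃ e : ℕ, (Algebra.leftMulMatrix β x).charpoly = minpoly k x ^ e := by
  have hx : IsIntegral k x := .of_finite k x
  set pb := adjoin.powerBasis hx
  set c := Module.finBasis k⟮x⟯ κ
  have h1 : (Algebra.leftMulMatrix β x).charpoly =
      (Algebra.leftMulMatrix (pb.basis.smulTower c) x).charpoly := by
    rw [← Algebra.toMatrix_lmul_eq, ← Algebra.toMatrix_lmul_eq, LinearMap.charpoly_toMatrix,
      LinearMap.charpoly_toMatrix]
  have h2 := Algebra.smulTower_leftMulMatrix_algebraMap pb.basis c (AdjoinSimple.gen k x)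
  rw [AdjoinSimple.algebraMap_gen] at h2
  have h3 : pb.gen = AdjoinSimple.gen k x := adjoin.powerBasis_gen hx
  refine ⟨Module.finrank k⟮x⟯ κ, ?_⟩
  rw [h1, h2, charpoly_blockDiagonal, Finset.prod_const, Finset.card_univ, Fintype.card_fin, ← h3,
    charpoly_leftMulMatrix pb, h3, minpoly_gen]

end Charpoly

section NormPoly

variable {k F : Type*} [Field k] [Field F] [Algebra k F] [Algebra k[X] F]
  [IsScalarTower k k[X] F] [FaithfulSMul k[X] F] (v : Ideal (Integers k F)) [v.IsMaximal]

theorem under_eq_span_minpoly :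
    v.under k[X] = Ideal.span {minpoly k (algebraMap k[X] (Integers k F ⧸ v) X)} := by
  have h : aeval (algebraMap k[X] (Integers k F ⧸ v) X) =
      IsScalarTower.toAlgHom k k[X] (Integers k F ⧸ v) :=
    Polynomial.algHom_ext (by rw [aeval_X]; rfl)
  have h2 := minpoly.ker_aeval_eq_span_minpoly k (algebraMap k[X] (Integers k F ⧸ v) X)
  rw [← Ideal.submodule_span_eq, ← h2, h]
  ext f
  rw [Ideal.mem_comap, RingHom.mem_ker, ← Ideal.Quotient.eq_zero_iff_mem]
  rfl

theorem under_ne_bot : v.under k[X] ≠ ⊥ :=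
  Ring.ne_bot_of_isMaximal_of_not_isField
    (Ideal.isMaximal_comap_of_isIntegral_of_isMaximal v) (not_isField k)

theorem ne_bot_of_isMaximal : v ≠ ⊥ := by
  rintro rfl
  refine under_ne_bot (⊥ : Ideal (Integers k F)) ?_
  exact Ideal.comap_bot_of_injective _ (FaithfulSMul.algebraMap_injective k[X] (Integers k F))

theorem minpoly_ne_zero : minpoly k (algebraMap k[X] (Integers k F ⧸ v) X) ≠ 0 := fun h => by
  have h1 := under_eq_span_minpoly v
  rw [h, Ideal.span_singleton_zero] at h1
  exact under_ne_bot v h1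

instance : IsScalarTower k (k[X] ⧸ v.under k[X]) (Integers k F ⧸ v) :=
  ⟨by
    rintro a ⟨b⟩ ⟨c⟩
    exact congrArg (Ideal.Quotient.mk v) (smul_assoc a b c)⟩

theorem finite_quotient_under : Module.Finite k (k[X] ⧸ v.under k[X]) := by
  rw [under_eq_span_minpoly]
  exact (minpoly.monic (minpoly.ne_zero_iff.1 (minpoly_ne_zero v))).finite_quotient

theorem finite_residueField [Module.Finite k[X] (Integers k F)] :
    Module.Finite k (Integers k F ⧸ v) :=
  have := finite_quotient_under v
  Module.Finite.trans (k[X] ⧸ v.under k[X]) _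

theorem normPoly_eq_charpoly [Module.Finite k[X] (Integers k F)] {ι : Type*} [Fintype ι]
    [DecidableEq ι] (β : Module.Basis ι k (Integers k F ⧸ v)) :
    normPoly v =
      (Algebra.leftMulMatrix β (algebraMap k[X] (Integers k F ⧸ v) X)).charpoly := by
  let _ : Field (Integers k F ⧸ v) := Ideal.Quotient.field v
  have hfin := finite_residueField v
  obtain ⟨e, he⟩ := charpoly_leftMulMatrix_eq_minpoly_pow β
    (algebraMap k[X] (Integers k F ⧸ v) X)
  have hmax : (v.under k[X]).IsMaximal := Ideal.isMaximal_comap_of_isIntegral_of_isMaximal v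
  let _ : Field (k[X] ⧸ v.under k[X]) := Ideal.Quotient.field _
  have hmonic : (minpoly k (algebraMap k[X] (Integers k F ⧸ v) X)).Monic :=
    minpoly.monic (.of_finite k _)
  -- The exponent is found by comparing degrees, using multiplicativity of dimension through the
  -- residue field of v₀.
  have h1 : v.inertiaDeg k[X] = e := by
    rw [Ideal.inertiaDeg_eq_of_isMaximal (v.under k[X])]
    have hfree : Module.Free (k[X] ⧸ v.under k[X]) (Integers k F ⧸ v) :=
      Module.Free.of_divisionRing _ _
    have h4 : Module.finrank k (k[X] ⧸ v.under k[X]) =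
        (minpoly k (algebraMap k[X] (Integers k F ⧸ v) X)).natDegree := by
      rw [under_eq_span_minpoly v, finrank_quotient_span_eq_natDegree]
    have h2 := Module.finrank_mul_finrank k (k[X] ⧸ v.under k[X]) (Integers k F ⧸ v)
    have h3 := congrArg natDegree he
    rw [Matrix.charpoly_natDegree_eq_dim, hmonic.natDegree_pow, ← Module.finrank_eq_card_basis β,
      ← h2, h4, mul_comm] at h3
    exact Nat.eq_of_mul_eq_mul_right (minpoly.natDegree_pos (.of_finite k _)) h3
  refine monicGenerator_eq (he ▸ hmonic.pow e) ?_
  rw [he, h1, under_eq_span_minpoly v, Ideal.span_singleton_pow]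

end NormPoly

/-! ### Normal bases modulo tame primes -/

section NormalBasis

variable {A B G : Type*} [CommRing A] [IsDedekindDomain A] [CommRing B] [IsDedekindDomain B]
  [Algebra A B] [Module.Finite A B] [Module.IsTorsionFree A B] [CommGroup G] [Finite G]
  [MulSemiringAction G B] [IsGaloisGroup G A B]

/-- In the tame case, `B / vB` has a normal basis over `A / v`. -/
theorem exists_normal_basis {v : Ideal A} [v.IsMaximal] [Finite (A ⧸ v)] (hv : v ≠ ⊥)
    {w : Ideal B} [w.IsMaximal] [w.LiesOver v] (hI : (Nat.card (w.inertia G) : B) ∉ w)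
    (hfin : Module.finrank (A ⧸ v) (B ⧸ v.map (algebraMap A B)) = Nat.card G)
    (ρ : AlgAction G A (B ⧸ v.map (algebraMap A B)))
    (hρ : ∀ g (y : B), ρ g (Ideal.Quotient.mk _ y) = Ideal.Quotient.mk _ (g • y)) :
    ∃ b : Module.Basis G (A ⧸ v) (B ⧸ v.map (algebraMap A B)), ∀ g, b g = ρ g (b 1) := by
  let _ : Field (A ⧸ v) := Ideal.Quotient.field v
  have := Fintype.ofFinite G
  have hlin : ∀ g (α : A ⧸ v) x, ρ g (α • x) = α • ρ g x := fun g α x => by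
    obtain ⟨a, rfl⟩ := Ideal.Quotient.mk_surjective α
    exact map_smul (ρ g) a x
  let r : Representation (A ⧸ v) G (B ⧸ v.map (algebraMap A B)) :=
    { toFun := fun g => { __ := (ρ g : _ →+ _), map_smul' := hlin g }
      map_one' := LinearMap.ext fun x => by
        change ρ 1 x = x
        rw [map_one, AlgHom.one_apply]
      map_mul' := fun g h => LinearMap.ext fun x => by
        change ρ (g * h) x = ρ g (ρ h x)
        rw [map_mul, AlgHom.mul_apply] }
  have hr : ∀ g x, r g x = ρ g x := fun _ _ => rfl
  obtain ⟨b, hb⟩ := exists_linearIndependent_translates r (by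
    rw [Fintype.linearIndependent_iff]
    intro c hc h
    choose a ha using fun g => Ideal.Quotient.mk_surjective (c g)
    rw [← ha, Ideal.Quotient.eq_zero_iff_mem]
    refine mem_of_sum_smul_mem_map hv hI (c := a) (fun y => ?_) h
    have h1 := LinearMap.congr_fun hc (Ideal.Quotient.mk _ y)
    rw [LinearMap.sum_apply, LinearMap.zero_apply] at h1
    rw [← Ideal.Quotient.eq_zero_iff_mem, ← h1, map_sum]
    refine Finset.sum_congr rfl fun g _ => ?_
    rw [LinearMap.smul_apply, hr, hρ, ← ha]
    rfl)
  refine ⟨basisOfLinearIndependentOfCardEqFinrank hb (by rw [hfin, Nat.card_eq_fintype_card]),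
    fun g => ?_⟩
  rw [coe_basisOfLinearIndependentOfCardEqFinrank, hr, hr, map_one, AlgHom.one_apply]

end NormalBasis


/-! ### Rings of integers and the final assembly -/

section Instances

variable (k L : Type*) [Field k] [Field L] [Algebra k[X] L] [Algebra k⟮X⟯ L]
  [IsScalarTower k[X] k⟮X⟯ L]

theorem faithfulSMul_polynomial : FaithfulSMul k[X] L :=
  (faithfulSMul_iff_algebraMap_injective _ _).2 (by
    rw [IsScalarTower.algebraMap_eq k[X] k⟮X⟯ L]
    exact (algebraMap k⟮X⟯ L).injective.comp (FaithfulSMul.algebraMap_injective k[X] k⟮X⟯))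

variable [FiniteDimensional k⟮X⟯ L] [Algebra.IsSeparable k⟮X⟯ L]

theorem isDedekindDomain_integers : IsDedekindDomain (Integers k L) :=
  integralClosure.isDedekindDomain k[X] k⟮X⟯ L

theorem finite_integers : Module.Finite k[X] (Integers k L) :=
  IsIntegralClosure.finite k[X] k⟮X⟯ L (Integers k L)

omit [Algebra.IsSeparable k⟮X⟯ L] in
theorem isFractionRing_integers : IsFractionRing (Integers k L) L :=
  integralClosure.isFractionRing_of_finite_extension k⟮X⟯ L

end Instances

section Relative

variable {k F K : Type*} [Field k] [Field F] [Field K] [Algebra k[X] F] [Algebra k[X] K]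
  [Algebra F K] [IsScalarTower k[X] F K]

instance : IsScalarTower (Integers k F) (Integers k K) K :=
  IsScalarTower.of_algebraMap_eq fun _ => rfl

instance : Module.IsTorsionFree (Integers k F) (Integers k K) :=
  (faithfulSMul_iff_algebraMap_injective _ _).2 (fun _ _ h =>
    Subtype.ext ((algebraMap F K).injective (congrArg Subtype.val h))) |>.to_isTorsionFree

theorem galQuot_mk (v : Ideal (Integers k F)) (g : Gal(K/F)) (y : Integers k K) :
    galQuot K v g (Ideal.Quotient.mk _ y) = Ideal.Quotient.mk _ (g • y) := rfl

end Relative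

theorem pow_card_pow_add {k R : Type*} [Field k] [Fintype k] [CommRing R] [Algebra k R] (n : ℕ)
    (x y : R) : (x + y) ^ Fintype.card k ^ n = x ^ Fintype.card k ^ n + y ^ Fintype.card k ^ n := by
  induction n with
  | zero => simp
  | succ n ih =>
    rw [pow_succ, pow_mul, pow_mul, pow_mul, ih]
    exact map_add (FiniteField.frobeniusAlgHom k R) _ _

theorem asAlgebraHom_trivialIdempotent_mul {k R S G : Type*} [Field k] [CommRing R] [Algebra k R]
    [CommRing S] [Algebra R S] [Algebra k S] [IsScalarTower k R S] [CommGroup G] [Fintype G]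
    (ρ : AlgAction G R S) (I : Subgroup G) [Fintype I] (σ : G) (s : S) :
    (rep k ρ).asAlgebraHom (trivialIdempotent I * MonoidAlgebra.of k G σ) s =
      (Nat.card I : k)⁻¹ • ∑ g : I, ρ (g.1 * σ) s := by
  rw [trivialIdempotent, smul_mul_assoc, map_smul, LinearMap.smul_apply, Finset.sum_mul, map_sum,
    LinearMap.sum_apply]
  congr 1
  refine Finset.sum_congr (by ext; simp) fun g _ => ?_
  rw [← map_mul, Representation.asAlgebraHom_of]
  rfl


section Residue

variable {k A B G : Type*} [Field k] [Fintype k] [CommRing A] [IsDedekindDomain A] [CommRing B]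
  [IsDedekindDomain B] [Algebra A B] [Module.Finite A B] [Module.IsTorsionFree A B]
  [Algebra k A] [Algebra k B] [IsScalarTower k A B] [CommGroup G] [Fintype G]
  [MulSemiringAction G B] [IsGaloisGroup G A B]

/-- The sizes of `B / vB` and of its Carlitz twist, in the tame case. -/
theorem free_and_size_of_tame {v : Ideal A} [v.IsMaximal] [Module.Finite k (A ⧸ v)] (hv : v ≠ ⊥)
    (htame : ∀ (w : Ideal B) [w.IsMaximal] [w.LiesOver v], (Nat.card (w.inertia G) : k) ≠ 0)
    (hfin : Module.finrank (A ⧸ v) (B ⧸ v.map (algebraMap A B)) = Nat.card G)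
    (ρ : AlgAction G A (B ⧸ v.map (algebraMap A B)))
    (hρ : ∀ g (y : B), ρ g (Ideal.Quotient.mk _ y) = Ideal.Quotient.mk _ (g • y)) :
    (∀ f : Module.End (MonoidAlgebra k G) (rep k ρ).asModule,
      Module.Free (MonoidAlgebra k G) (Module.AEval' f) ∧
      Module.Finite (MonoidAlgebra k G) (Module.AEval' f) ∧
      Module.finrank (MonoidAlgebra k G) (Module.AEval' f) = Module.finrank k (A ⧸ v)) ∧
    ∃ β : Module.Basis (Fin (Module.finrank k (A ⧸ v))) k (A ⧸ v),
      (∀ a : A, size (MonoidAlgebra k G) (Module.AEval' (mulEnd k ρ a)) =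
        (Algebra.leftMulMatrix β (algebraMap A (A ⧸ v) a)).charpoly.map
          (algebraMap k (MonoidAlgebra k G))) ∧
      ∀ (a : A) (w : Ideal B) [w.IsMaximal] [w.LiesOver v] (σ : G), IsArithFrobAt A σ w →
        size (MonoidAlgebra k G) (Module.AEval' (mulEnd k ρ a + frobEnd k ρ)) =
          (Algebra.leftMulMatrix β (algebraMap A (A ⧸ v) a)).charpoly.map
            (algebraMap k (MonoidAlgebra k G)) -
            C (trivialIdempotent (w.inertia G) * MonoidAlgebra.of k G σ) := by
  classical
  let _ : Field (A ⧸ v) := Ideal.Quotient.field v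
  have : Finite (A ⧸ v) := Module.finite_of_finite k
  have : IsScalarTower k (A ⧸ v) (B ⧸ v.map (algebraMap A B)) := ⟨by
    rintro c ⟨a⟩ ⟨y⟩
    exact congrArg (Ideal.Quotient.mk (v.map (algebraMap A B))) (smul_assoc c a y)⟩
  -- One auxiliary prime suffices for the normal basis; the Frobenius formula below is checked for
  -- an arbitrary one.
  obtain ⟨w, hw, hwv⟩ := Ideal.exists_maximal_ideal_liesOver_of_isIntegral (S := B) v
  have hI : (Nat.card (w.inertia G) : B) ∉ w := fun h => by
    have h1 := (IsUnit.mk0 _ (htame w)).map (algebraMap k B)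
    rw [map_natCast] at h1
    exact hw.ne_top (Ideal.eq_top_of_isUnit_mem w h h1)
  obtain ⟨b, hb⟩ := exists_normal_basis hv hI hfin ρ hρ
  have hlin : ∀ g (α : A ⧸ v) x, ρ g (α • x) = α • ρ g x := fun g α x => by
    obtain ⟨a, rfl⟩ := Ideal.Quotient.mk_surjective α
    exact map_smul (ρ g) a x
  refine ⟨free_finite_finrank_aeval ρ hlin b hb, Module.finBasis k (A ⧸ v),
    size_mulEnd ρ hlin b hb, fun a w _ _ σ hσ => size_mulEnd_add_frobEnd ρ hlin b hb a _ fun s => ?_⟩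
  have hq : Nat.card (A ⧸ v) = Fintype.card k ^ Module.finrank k (A ⧸ v) := by
    rw [← Nat.card_eq_fintype_card, Module.natCard_eq_pow_finrank (K := k)]
  obtain ⟨x, rfl⟩ := Ideal.Quotient.mk_surjective s
  have h1 := frobenius_sub_pow_mem_map hv
    (i := algebraMap k A (Nat.card (w.inertia G) : k)⁻¹) (by
      rw [← map_natCast (algebraMap k A), ← map_mul, inv_mul_cancel₀ (htame w), map_one]) hσ
    (fun x y => by rw [hq]; exact pow_card_pow_add _ x y) x
  rw [← Ideal.Quotient.mk_eq_mk_iff_sub_mem, algebraMap_smul] at h1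
  rw [asAlgebraHom_trivialIdempotent_mul, ← hq, ← map_pow, ← h1]
  change (Nat.card (w.inertia G) : k)⁻¹ • Ideal.Quotient.mk (v.map (algebraMap A B)) _ = _
  rw [map_sum]
  simp_rw [hρ]

end Residue

end DrinfeldEuler

open DrinfeldEuler
theorem propositionP
    {k : Type*} [Field k] [Fintype k]
    {F : Type*} [Field F] [Algebra k F] [Algebra k[X] F] [Algebra k⟮X⟯ F]
    [IsScalarTower k k[X] F] [IsScalarTower k[X] k⟮X⟯ F]
    [FiniteDimensional k⟮X⟯ F] [Algebra.IsSeparable k⟮X⟯ F]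
    {K : Type*} [Field K] [Algebra k K] [Algebra k[X] K] [Algebra F K]
    [IsScalarTower k k[X] K] [IsScalarTower k[X] F K]
    [FiniteDimensional F K] [IsAbelianGalois F K]
    (hconst : ∀ x : K, IsAlgebraic k x → ∃ c : k, algebraMap k K c = x)
    (v : Ideal (Integers k F)) [v.IsMaximal] (hv : TamelyRamified K v) :
    (Module.Free (MonoidAlgebra k Gal(K/F)) (tModule k (galQuot K v)) ∧
      Module.Finite (MonoidAlgebra k Gal(K/F)) (tModule k (galQuot K v)) ∧
      Module.finrank (MonoidAlgebra k Gal(K/F)) (tModule k (galQuot K v)) =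
        Module.finrank k (Integers k F ⧸ v)) ∧
    (∀ E : DrinfeldModule k (Integers k F),
      Module.Free (MonoidAlgebra k Gal(K/F)) (E.points (galQuot K v)) ∧
      Module.Finite (MonoidAlgebra k Gal(K/F)) (E.points (galQuot K v)) ∧
      Module.finrank (MonoidAlgebra k Gal(K/F)) (E.points (galQuot K v)) =
        Module.finrank k (Integers k F ⧸ v)) ∧
    size (MonoidAlgebra k Gal(K/F)) (tModule k (galQuot K v)) =
      (normPoly v).map (algebraMap k (MonoidAlgebra k Gal(K/F))) ∧
    (∀ (w : Ideal (Integers k K)) [w.IsMaximal] [w.LiesOver v] (σ : Gal(K/F)),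
      IsArithFrobAt (Integers k F) σ w →
      size (MonoidAlgebra k Gal(K/F)) ((carlitz k (Integers k F)).points (galQuot K v)) =
        (normPoly v).map (algebraMap k (MonoidAlgebra k Gal(K/F))) -
          C (trivialIdempotent (w.inertia Gal(K/F)) * MonoidAlgebra.of k Gal(K/F) σ)) := by
  have := faithfulSMul_polynomial k F
  have := isDedekindDomain_integers k F
  have := finite_integers k F
  have := isFractionRing_integers k F
  let _ : Algebra k⟮X⟯ K := ((algebraMap F K).comp (algebraMap k⟮X⟯ F)).toAlgebra
  have : IsScalarTower k⟮X⟯ F K := IsScalarTower.of_algebraMap_eq fun _ => rfl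
  have : IsScalarTower k[X] k⟮X⟯ K := IsScalarTower.of_algebraMap_eq fun x => by
    rw [IsScalarTower.algebraMap_apply k[X] F K, IsScalarTower.algebraMap_apply k[X] k⟮X⟯ F]
    rfl
  have : FiniteDimensional k⟮X⟯ K := Module.Finite.trans F K
  have : Algebra.IsSeparable k⟮X⟯ K := .trans k⟮X⟯ F K
  have := isDedekindDomain_integers k K
  have := finite_integers k K
  have := isFractionRing_integers k K
  have : Module.Finite (Integers k F) (Integers k K) :=
    Module.Finite.of_restrictScalars_finite k[X] _ _
  have : IsGaloisGroup Gal(K/F) (Integers k F) (Integers k K) :=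
    IsGaloisGroup.of_isFractionRing _ _ _ F K
  have := finite_residueField v
  have hnorm := normPoly_eq_charpoly v (ι := Fin (Module.finrank k (Integers k F ⧸ v)))
  rw [IsScalarTower.algebraMap_eq k[X] (Integers k F) (Integers k F ⧸ v)] at hnorm
  obtain ⟨hfree, β, hsize, hcarlitz⟩ := free_and_size_of_tame (k := k) (ne_bot_of_isMaximal v)
    (fun w hw hwv h => by
      have : Finite (Integers k F ⧸ v) := Module.finite_of_finite k
      -- The inertia order is the ramification index, so tameness makes it invertible in `k`.
      rw [card_inertia_eq_ramificationIdx (A := Integers k F) (v := v) w] at h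
      exact hv w hw hwv ((ringChar.spec k _).1 h))
    ((Ideal.finrank_quotient_map v F K).trans (IsGalois.card_aut_eq_finrank F K).symm)
    (galQuot K v) (galQuot_mk v)
  refine ⟨hfree _, fun E => hfree _, ?_, fun w _ _ σ hσ => ?_⟩
  · rw [hnorm β]
    exact hsize _
  · rw [hnorm β]
    have h := hcarlitz (algebraMap k[X] (Integers k F) X) w σ hσ
    rw [← twistedAction_carlitz] at h
    exact h
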